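/- Let $k$ be an algebraically closed field of characteristic zero and let $H$ be an affine algebraic group over $k$, i.e. the group scheme $\operatorname{Spec} k[H]$ of a finitely generated commutative Hopf algebra $k[H]$ over $k$. Let $\operatorname{Rep}(H)$ be the DG category of representations of $H$, that is, the unbounded derived (DG) category of the abelian category of right $k[H]$-comodules. Then the regular representation $k[H]$ (the comodule $k[H]$ with the coaction $\Delta: k[H]\to k[H]\otimes_k k[H]$, placed in degree $0$) generates $\operatorname{Rep}(H)$ under filtered colimits: every strictly full DG subcategory of $\operatorname{Rep}(H)$ (a strictly full subcategory containing $0$ and closed under shifts in both directions and under cones) that contains $k[H]$ and is closed under small filtered (homotopy) colimits is equal to $\operatorname{Rep}(H)$. -/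

import Mathlib

open CategoryTheory Limits MonoidalCategory TensorProduct

universe u

noncomputable section

namespace AlgGroup

section Comodules

variable (k : Type u) [Field k] (A : Type u) [CommRing A] [HopfAlgebra k A]

/-- The map `M ⊗ A → M`, `m ⊗ a ↦ ε(a) m`. -/
def counitMap (M : Type u) [AddCommGroup M] [Module k M] : M ⊗[k] A →ₗ[k] M :=
  (TensorProduct.rid k M).toLinearMap ∘ₗ LinearMap.lTensor M (Coalgebra.counit (R := k) (A := A))

/-- The map `M ⊗ A → (M ⊗ A) ⊗ A`, `m ⊗ a ↦ ∑ (m ⊗ a₍₁₎) ⊗ a₍₂₎`. -/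
def comulMap (M : Type u) [AddCommGroup M] [Module k M] : M ⊗[k] A →ₗ[k] (M ⊗[k] A) ⊗[k] A :=
  (TensorProduct.assoc k M A A).symm.toLinearMap ∘ₗ
    LinearMap.lTensor M (Coalgebra.comul (R := k) (A := A))

theorem counitMap_naturality {M N : Type u} [AddCommGroup M] [Module k M] [AddCommGroup N]
    [Module k N] (f : M →ₗ[k] N) :
    counitMap k A N ∘ₗ LinearMap.rTensor A f = f ∘ₗ counitMap k A M := by
  apply TensorProduct.ext'
  intro m a
  simp [counitMap]

theorem comulMap_naturality {M N : Type u} [AddCommGroup M] [Module k M] [AddCommGroup N]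
    [Module k N] (f : M →ₗ[k] N) :
    comulMap k A N ∘ₗ LinearMap.rTensor A f =
      LinearMap.rTensor A (LinearMap.rTensor A f) ∘ₗ comulMap k A M := by
  apply TensorProduct.ext'
  intro m a
  simp only [comulMap, LinearMap.comp_apply, LinearMap.rTensor_tmul, LinearMap.lTensor_tmul,
    LinearEquiv.coe_coe]
  induction Coalgebra.comul (R := k) a with
  | zero => simp
  | tmul x y => simp
  | add x y hx hy => simp only [TensorProduct.tmul_add, map_add, hx, hy]

theorem comulMap_coassoc (M : Type u) [AddCommGroup M] [Module k M] :
    LinearMap.rTensor A (comulMap k A M) ∘ₗ comulMap k A M =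
      comulMap k A (M ⊗[k] A) ∘ₗ comulMap k A M := by
  apply TensorProduct.ext'
  intro m a
  let φ : A ⊗[k] (A ⊗[k] A) →ₗ[k] ((M ⊗[k] A) ⊗[k] A) ⊗[k] A :=
    (TensorProduct.assoc k (M ⊗[k] A) A A).symm.toLinearMap ∘ₗ
      (TensorProduct.assoc k M A (A ⊗[k] A)).symm.toLinearMap ∘ₗ
        TensorProduct.mk k M _ m
  have h1 : ∀ x : A ⊗[k] A, LinearMap.rTensor A (comulMap k A M)
      ((TensorProduct.assoc k M A A).symm (m ⊗ₜ x)) =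
      φ (TensorProduct.assoc k A A A (Coalgebra.comul.rTensor A x)) := by
    intro x
    induction x with
    | zero => simp
    | tmul x y =>
      simp only [comulMap, TensorProduct.assoc_symm_tmul, LinearMap.rTensor_tmul,
        LinearMap.comp_apply, LinearMap.lTensor_tmul, LinearEquiv.coe_coe]
      induction Coalgebra.comul (R := k) x with
      | zero => simp
      | tmul x y => simp [φ]
      | add x y hx hy => simp only [TensorProduct.tmul_add, TensorProduct.add_tmul, map_add, hx, hy]
    | add x y hx hy => simp only [TensorProduct.tmul_add, map_add, hx, hy]
  have h2 : ∀ x : A ⊗[k] A, comulMap k A (M ⊗[k] A)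
      ((TensorProduct.assoc k M A A).symm (m ⊗ₜ x)) =
      φ (Coalgebra.comul.lTensor A x) := by
    intro x
    induction x with
    | zero => simp
    | tmul x y => simp [comulMap, φ]
    | add x y hx hy => simp only [TensorProduct.tmul_add, map_add, hx, hy]
  have h3 : comulMap k A M (m ⊗ₜ a) =
      (TensorProduct.assoc k M A A).symm (m ⊗ₜ Coalgebra.comul (R := k) a) := by
    simp [comulMap]
  rw [LinearMap.comp_apply, LinearMap.comp_apply, h3, h1, h2, Coalgebra.coassoc_apply]

theorem counitMap_left (M : Type u) [AddCommGroup M] [Module k M] :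
    counitMap k A (M ⊗[k] A) ∘ₗ comulMap k A M = LinearMap.id := by
  apply TensorProduct.ext'
  intro m a
  have h1 : ∀ x : A ⊗[k] A, counitMap k A (M ⊗[k] A)
      ((TensorProduct.assoc k M A A).symm (m ⊗ₜ x)) =
      m ⊗ₜ (TensorProduct.rid k A (Coalgebra.counit.lTensor A x)) := by
    intro x
    induction x with
    | zero => simp
    | tmul x y => simp [counitMap]
    | add x y hx hy => simp only [TensorProduct.tmul_add, map_add, hx, hy]
  have h3 : comulMap k A M (m ⊗ₜ a) =
      (TensorProduct.assoc k M A A).symm (m ⊗ₜ Coalgebra.comul (R := k) a) := by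
    simp [comulMap]
  rw [LinearMap.comp_apply, h3, h1]
  simp

theorem counitMap_right (M : Type u) [AddCommGroup M] [Module k M] :
    LinearMap.rTensor A (counitMap k A M) ∘ₗ comulMap k A M = LinearMap.id := by
  apply TensorProduct.ext'
  intro m a
  have h1 : ∀ x : A ⊗[k] A, LinearMap.rTensor A (counitMap k A M)
      ((TensorProduct.assoc k M A A).symm (m ⊗ₜ x)) =
      m ⊗ₜ (TensorProduct.lid k A (Coalgebra.counit.rTensor A x)) := by
    intro x
    induction x with
    | zero => simp
    | tmul x y => simp [counitMap, TensorProduct.smul_tmul]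
    | add x y hx hy => simp only [TensorProduct.tmul_add, map_add, hx, hy]
  have h3 : comulMap k A M (m ⊗ₜ a) =
      (TensorProduct.assoc k M A A).symm (m ⊗ₜ Coalgebra.comul (R := k) a) := by
    simp [comulMap]
  rw [LinearMap.comp_apply, h3, h1]
  simp

/-- The comonad `M ↦ M ⊗ A` on `k`-vector spaces. -/
def comonad : Comonad (ModuleCat.{u} k) where
  toFunctor := tensorRight (ModuleCat.of k A)
  ε :=
    { app M := ModuleCat.ofHom (counitMap k A M)
      naturality _ _ f := ModuleCat.hom_ext (counitMap_naturality k A f.hom) }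
  δ :=
    { app M := ModuleCat.ofHom (comulMap k A M)
      naturality _ _ f := ModuleCat.hom_ext (comulMap_naturality k A f.hom) }
  coassoc M := ModuleCat.hom_ext (comulMap_coassoc k A M)
  left_counit M := ModuleCat.hom_ext (counitMap_left k A M)
  right_counit M := ModuleCat.hom_ext (counitMap_right k A M)

instance : (comonad k A).toFunctor.Additive :=
  inferInstanceAs (tensorRight (ModuleCat.of k A)).Additive

instance : PreservesFiniteLimits (comonad k A).toFunctor :=
  inferInstanceAs (PreservesFiniteLimits (tensorRight (ModuleCat.of k A)))

/-- The category of right `A`-comodules: a coalgebra over the comonad `M ↦ M ⊗ A` is a `k`-vector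
space `V` with a `k`-linear coaction `ρ : V → V ⊗ A` such that `(id ⊗ ε) ∘ ρ = id` and
`(id ⊗ Δ) ∘ ρ = (ρ ⊗ id) ∘ ρ`, and morphisms are the `k`-linear maps that commute with the coactions.
If `A = k[H]`, this is the abelian category of (algebraic) representations of `H`. -/
abbrev Comod : Type (u + 1) := (comonad k A).Coalgebra

instance : HasFiniteLimits (Comod k A) where
  out _ _ _ := hasLimitsOfShape_of_hasLimitsOfShape_createsLimitsOfShape (comonad k A).forget

instance : HasColimitsOfSize.{u, u} (Comod k A) :=
  hasColimits_of_hasColimits_createsColimits (comonad k A).forget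

instance : HasFiniteColimits (Comod k A) := hasFiniteColimits_of_hasColimits _
instance : PreservesFiniteLimits (comonad k A).forget where
  preservesFiniteLimits _ _ _ := inferInstance

instance : HasFiniteBiproducts (Comod k A) := HasFiniteBiproducts.of_hasFiniteProducts

instance {X Y : Comod k A} (f : X ⟶ Y) : IsIso (Abelian.coimageImageComparison f) :=
  have := IsIso.of_isIso_fac_right (Abelian.PreservesCoimage.hom_coimageImageComparison
    (comonad k A).forget f).symm
  isIso_of_reflects_iso _ (comonad k A).forget

instance : Abelian (Comod k A) := Abelian.ofCoimageImageComparisonIsIso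

/-- The regular representation: `A` as a right comodule over itself, through `Δ : A → A ⊗ A`. -/
def regular : Comod k A where
  A := ModuleCat.of k A
  a := ModuleCat.ofHom (Coalgebra.comul (R := k) (A := A))
  counit := by
    apply ModuleCat.hom_ext
    ext a
    change counitMap k A A (Coalgebra.comul (R := k) a) = a
    simp [counitMap]
  coassoc := by
    apply ModuleCat.hom_ext
    ext a
    change comulMap k A A (Coalgebra.comul (R := k) a) =
      LinearMap.rTensor A (Coalgebra.comul (R := k)) (Coalgebra.comul (R := k) a)
    rw [← Coalgebra.coassoc_symm_apply]
    rfl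

instance : HasDerivedCategory.{u + 1} (Comod k A) := HasDerivedCategory.standard _

/-- The unbounded derived category of right `A`-comodules. If `A = k[H]`, this is (the homotopy
category of) the DG category `Rep(H)`. -/
abbrev DGRep : Type (u + 1) := DerivedCategory (Comod k A)

/-- The regular representation, placed in degree zero. -/
def dgRegular : DGRep k A :=
  (DerivedCategory.singleFunctor (Comod k A) 0).obj (regular k A)

variable {k A}

/-- A full subcategory of `Rep(H)` is closed under filtered colimits (in the DG sense) if it
contains the object presented by `colim F` as soon as it contains those presented by all `F j`, for
every small filtered diagram `F` of complexes of comodules. As filtered colimits of comodules are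
exact, `colim F` is also the homotopy colimit of `F`, and every small filtered diagram in the
`∞`-categorical sense can be presented in this way. -/
def IsClosedUnderFilteredColimits (P : ObjectProperty (DGRep k A)) : Prop :=
  ∀ (J : Type u) [SmallCategory J] [IsFiltered J] (F : J ⥤ CochainComplex (Comod k A) ℤ)
    (c : Cocone F), IsColimit c →
      (∀ j, P (DerivedCategory.Q.obj (F.obj j))) → P (DerivedCategory.Q.obj c.pt)

/-- The object `X` generates `Rep(H)` under filtered colimits: the only strictly full DG subcategory
(a strictly full subcategory that contains `0` and is closed under shifts and cones) which contains
`X` and is closed under filtered colimits is `Rep(H)` itself. -/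
def GeneratesUnderFilteredColimits (X : DGRep k A) : Prop :=
  ∀ P : ObjectProperty (DGRep k A), P.IsClosedUnderIsomorphisms → P.IsTriangulated →
    IsClosedUnderFilteredColimits P → P X → ∀ V : DGRep k A, P V

end Comodules

end AlgGroup

end

/-! The objects of the heart lying in a subcategory as in the statement form a class `S` of
comodules closed under extensions, kernels of epimorphisms and filtered colimits
(`IsFilteredThick`), hence under retracts. If `S` is everything, so is the subcategory: bounded
objects are iterated extensions of shifted objects of the heart, and every complex is an increasing
union of bounded subcomplexes (`DerivedCategory.prop_of_sequential_colimits`). It remains to show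
that `A ∈ S` forces `S` to be everything, where `A = k[H]`.

Embed `H` into a special linear group `G` (`exists_matrix`), and let `B = k[G]`, with `H` acting by
right translation `β`. Three properties of `B` matter. It is noetherian. The map `B ⊗ B → B ⊗ A`, `b
⊗ b' ↦ (b ⊗ 1) β(b')`, is surjective, that is, `(g, h) ↦ (g, gh)` is a closed immersion. Finally,
there is an invariant linear form `J` on `B` with `J 1 = 1`, the Reynolds operator. Through `J`,
every comodule `X` is a retract of `B ⊗ X`, which is a Hopf module: a comodule with a compatible
action of `B`. So Hopf modules suffice.

The core is `Has.of_hopfModule`. Let `V` be a Hopf module killed by a subcomodule ideal `I`, and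
suppose that `B ⧸ J ∈ S` for all subcomodule ideals `J > I`. The coaction embeds `V` into the cofree
comodule `N = V ⊗ A`, which lies in `S`, being a direct sum of copies of `A`. Let `B` act on `N`
through `β`; then `I` kills `N`, and surjectivity shows that `N` is generated by the elements `v ⊗
1`, whose orbit maps `B → N` are colinear. Choose `L` maximal among the stable `B`-submodules of `N`
that meet `V` in `0`. Then `N ⧸ (V ⊕ L)` is filtered by cyclic modules `B ⧸ J`, and `J > I` for
every generator outside `L`, since otherwise that generator could be added to `L`. So the quotient
lies in `S`, then the kernel `V ⊕ L`, then its retract `V`. Noetherian induction gives `B ⧸ I ∈ S`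
for all `I` (`has_quot_ideal`), and the case `I = 0` then covers all Hopf modules.

The form `J` is explicit. For the apolar pairing of polynomials, a linear substitution is adjoint to
the transposed one, so pairing with `det ^ p` is semi-invariant. The normalized forms `detPowCoeff`
satisfy `detPowCoeff_succ`, so their sum over `p` vanishes on the ideal `(det - 1)` and descends to
`B`. Characteristic zero makes the normalization possible. -/

noncomputable section

/-! ### Bounded objects are built from the heart -/

namespace DerivedCategory

open Triangulated Pretriangulated ZeroObject

universe w v'  u'

variable {C : Type u'} [Category.{v'} C] [Abelian C] [HasDerivedCategory.{w} C]

/-- A triangulated subcategory of the derived category that contains the objects of the heart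
contains every bounded object. -/
theorem prop_of_isGE_of_isLE (P : ObjectProperty (DerivedCategory C))
    [P.IsClosedUnderIsomorphisms] [P.IsTriangulated]
    (h0 : ∀ X : C, P ((singleFunctor C 0).obj X)) (d : ℕ) :
    ∀ (a b : ℤ) (X : DerivedCategory C), b = a + d → X.IsGE a → X.IsLE b → P X := by
  have hs (n : ℤ) (X : C) : P ((singleFunctor C n).obj X) := by
    have e := ((singleFunctors C).shiftIso (-n) n 0 (by simp)).app X
    exact P.prop_of_iso e (P.le_shift (-n) _ (h0 X))
  induction d with
  | zero =>
    intro a b X hab h1 h2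
    obtain rfl : b = a := by simpa using hab
    obtain ⟨Y, ⟨e⟩⟩ := exists_iso_singleFunctor_obj_of_isGE_of_isLE X b
    exact P.prop_of_iso e.symm (hs _ _)
  | succ d ih =>
    intro a b X hab h1 h2
    obtain ⟨A, B, hA, hB, f, g, h, hT⟩ := TStructure.t.exists_triangle X (a + d) b (by
      push_cast at hab; lia)
    have hA : A.IsLE (a + d) := ⟨hA⟩
    have hB : B.IsGE b := ⟨hB⟩
    -- In the rotated triangles, `A` sits between `B⟦-1⟧` and `X`, and `B` between `X` and `A⟦1⟧`;
    -- this bounds each truncation on its other side.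
    have hA' : A.IsGE a := TStructure.t.isGE₂ _ (inv_rot_of_distTriang _ hT) a
      (by
        have := TStructure.t.isGE_shift B b (-1) (b + 1)
        exact TStructure.t.isGE_of_ge (B⟦(-1 : ℤ)⟧) a (b + 1)) h1
    have hB' : B.IsLE b := TStructure.t.isLE₂ _ (rot_of_distTriang _ hT) b h2
      (by
        have := TStructure.t.isLE_shift A (a + d) 1 (a + d - 1)
        exact TStructure.t.isLE_of_le (A⟦(1 : ℤ)⟧) (a + d - 1) b)
    exact P.ext_of_isTriangulatedClosed₂ _ hT (ih _ _ A rfl hA' hA)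
      (by
        obtain ⟨Y, ⟨e⟩⟩ := exists_iso_singleFunctor_obj_of_isGE_of_isLE B b
        exact P.prop_of_iso e.symm (hs _ _))

end DerivedCategory

/-! ### Exhaustion of a complex by bounded subcomplexes -/

namespace CochainComplex

open ZeroObject

universe v' u'

variable {C : Type u'} [Category.{v'} C] [Abelian C]

/-- The subcomplex given by a family of subobjects that is stable under the differential. -/
@[simps]
def subcomplex (K : CochainComplex C ℤ) (U : ∀ i, Subobject (K.X i))
    (h : ∀ i j, (U j).Factors ((U i).arrow ≫ K.d i j)) : CochainComplex C ℤ where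
  X i := (U i : C)
  d i j := (U j).factorThru _ (h i j)
  shape i j hij := by
    rw [← cancel_mono (U j).arrow]
    simp [K.shape i j hij]
  d_comp_d' i j l _ _ := by
    rw [← cancel_mono (U l).arrow]
    simp

/-- The inclusion of a subcomplex. -/
@[simps]
def subcomplexι (K : CochainComplex C ℤ) (U : ∀ i, Subobject (K.X i))
    (h : ∀ i j, (U j).Factors ((U i).arrow ≫ K.d i j)) : subcomplex K U h ⟶ K where
  f i := (U i).arrow
  comm' i j _ := (Subobject.factorThru_arrow _ _ (h i j)).symm

theorem subcomplex_ofLE_comp_d (K : CochainComplex C ℤ) {U V : ∀ i, Subobject (K.X i)} (hUV : U ≤ V)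
    (hU : ∀ i j, (U j).Factors ((U i).arrow ≫ K.d i j))
    (hV : ∀ i j, (V j).Factors ((V i).arrow ≫ K.d i j)) (i j : ℤ) :
    Subobject.ofLE _ _ (hUV i) ≫ (V j).factorThru _ (hV i j) =
      (U j).factorThru _ (hU i j) ≫ Subobject.ofLE _ _ (hUV j) := by
  rw [← cancel_mono (V j).arrow]
  simp

/-- An increasing sequence of subcomplexes. -/
@[simps]
def subcomplexFunctor (K : CochainComplex C ℤ) (U : ℕ → ∀ i, Subobject (K.X i)) (hU : Monotone U)
    (h : ∀ n i j, (U n j).Factors ((U n i).arrow ≫ K.d i j)) :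
    ULift.{v'} ℕ ⥤ CochainComplex C ℤ where
  obj n := subcomplex K (U n.down) (h _)
  map {m n} φ :=
    { f i := Subobject.ofLE _ _ (hU (leOfHom φ : m ≤ n) i)
      comm' i j _ := by
        exact subcomplex_ofLE_comp_d K (hU (leOfHom φ : m ≤ n)) (h _) (h _) i j }
  map_id n := by
    ext i
    exact Subobject.ofLE_refl _
  map_comp f g := by
    ext i
    exact (Subobject.ofLE_comp_ofLE _ _ _ _ _).symm

/-- An increasing sequence of subcomplexes as a cocone. -/
@[simps]
def subcomplexCocone (K : CochainComplex C ℤ) (U : ℕ → ∀ i, Subobject (K.X i)) (hU : Monotone U)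
    (h : ∀ n i j, (U n j).Factors ((U n i).arrow ≫ K.d i j)) :
    Cocone (subcomplexFunctor K U hU h) where
  pt := K
  ι :=
    { app n := subcomplexι K _ _
      naturality m n f := by
        ext i
        exact (Subobject.ofLE_arrow (hU (leOfHom f : m ≤ n) i)).trans (Category.comp_id _).symm }

/-- A complex is the colimit of an increasing sequence of subcomplexes that is eventually everything
in each degree. -/
def isColimitSubcomplexCocone (K : CochainComplex C ℤ) (U : ℕ → ∀ i, Subobject (K.X i))
    (hU : Monotone U) (h : ∀ n i j, (U n j).Factors ((U n i).arrow ≫ K.d i j))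
    (N : ℤ → ℕ) (hN : ∀ i, U (N i) i = ⊤) : IsColimit (subcomplexCocone K U hU h) := by
  refine HomologicalComplex.isColimitOfEval _ _ fun i ↦ ?_
  have htop (n : ULift.{v'} ℕ) (hn : N i ≤ n.down) : IsIso ((U n.down i).arrow) := by
    have : U n.down i = ⊤ := top_unique ((hN i).ge.trans (hU hn i))
    rwa [Subobject.isIso_iff_mk_eq_top, Subobject.mk_arrow]
  have hc : (subcomplexFunctor K U hU h ⋙ HomologicalComplex.eval C _ i).IsEventuallyConstantFrom
      ⟨N i⟩ := by
    intro n f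
    have h1 := htop ⟨N i⟩ le_rfl
    have h2 := htop n (leOfHom f : ULift.up (N i) ≤ n)
    have h3 : (subcomplexFunctor K U hU h ⋙ HomologicalComplex.eval C _ i).map f ≫
      (U n.down i).arrow = (U (N i) i).arrow := Subobject.ofLE_arrow _
    have h4 : IsIso ((subcomplexFunctor K U hU h ⋙ HomologicalComplex.eval C _ i).map f ≫
      (U n.down i).arrow) := by rw [h3]; exact h1
    exact @IsIso.of_isIso_comp_right _ _ _ _ _ _ (U n.down i).arrow h2 h4
  have : IsIso (((HomologicalComplex.eval C (ComplexShape.up ℤ) i).mapCocone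
      (subcomplexCocone K U hU h)).ι.app ⟨N i⟩) := htop ⟨N i⟩ le_rfl
  exact hc.isColimitOfIsIso _

/-- The subobjects of a complex that vanish outside of `[-n, n]`, are everything in `[-n, n)`, and
consist of the cycles in degree `n`. -/
def truncSubobject (K : CochainComplex C ℤ) (n : ℕ) (i : ℤ) : Subobject (K.X i) :=
  if i < -n then ⊥ else if i < n then ⊤ else if i = n then kernelSubobject (K.d i (i + 1)) else ⊥

theorem truncSubobject_monotone (K : CochainComplex C ℤ) : Monotone (truncSubobject K) := by
  intro m n hmn i
  unfold truncSubobject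
  split_ifs <;> first | exact le_rfl | exact bot_le | exact le_top | (exfalso; lia)

/-- Only the step from degree `n - 1` to degree `n` uses that boundaries are cycles. Elsewhere the
differential lands in a whole object, or starts from `0` or from cycles and vanishes. -/
theorem truncSubobject_factors (K : CochainComplex C ℤ) (n : ℕ) (i j : ℤ) :
    (truncSubobject K n j).Factors ((truncSubobject K n i).arrow ≫ K.d i j) := by
  by_cases hij : i + 1 = j
  · subst hij
    by_cases hi : -n ≤ i ∧ i < n
    · by_cases hj : i + 1 < n
      · rw [show truncSubobject K n (i + 1) = ⊤ by
          rw [truncSubobject, if_neg (by lia), if_pos hj]]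
        exact Subobject.top_factors _
      · rw [show truncSubobject K n (i + 1) = kernelSubobject (K.d (i + 1) (i + 1 + 1)) by
          rw [truncSubobject, if_neg (by lia), if_neg hj, if_pos (by lia)]]
        exact kernelSubobject_factors _ _ (by simp)
    · have h : (truncSubobject K n i).arrow ≫ K.d i (i + 1) = 0 := by
        by_cases h2 : i = n
        · rw [show truncSubobject K n i = kernelSubobject (K.d i (i + 1)) by
            rw [truncSubobject, if_neg (by lia), if_neg (by lia), if_pos h2]]
          exact kernelSubobject_arrow_comp _
        · rw [show truncSubobject K n i = ⊥ by
            rw [truncSubobject]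
            split_ifs <;> first | rfl | (exfalso; lia)]
          rw [Subobject.bot_arrow, zero_comp]
      rw [h]
      exact Subobject.factors_zero
  · rw [K.shape _ _ (by simpa using hij), comp_zero]
    exact Subobject.factors_zero

end CochainComplex

/-! ### From bounded to unbounded complexes -/

namespace DerivedCategory

open ZeroObject CochainComplex

universe w v' u'

variable {C : Type u'} [Category.{v'} C] [Abelian C] [HasDerivedCategory.{w} C]

/-- A triangulated subcategory of the derived category that contains the objects of the heart and
is closed under sequential colimits of complexes is everything. -/
theorem prop_of_sequential_colimits (P : ObjectProperty (DerivedCategory C))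
    [P.IsClosedUnderIsomorphisms] [P.IsTriangulated]
    (hP : ∀ (F : ULift.{v'} ℕ ⥤ CochainComplex C ℤ) (c : Cocone F), IsColimit c →
      (∀ j, P (Q.obj (F.obj j))) → P (Q.obj c.pt))
    (h0 : ∀ X : C, P ((singleFunctor C 0).obj X)) (X : DerivedCategory C) : P X := by
  refine P.prop_of_iso (Q.objObjPreimageIso X) ?_
  set K := Q.objPreimage X
  -- Only cycles are kept in degree `n`, so the subobject is everything in degree `i` once `n` is
  -- strictly larger than `|i|`; hence `natAbs + 1`.
  refine hP _ _ (isColimitSubcomplexCocone K (truncSubobject K) (truncSubobject_monotone K)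
    (truncSubobject_factors K) (fun i ↦ i.natAbs + 1) fun i ↦ ?_) fun n ↦ ?_
  · unfold truncSubobject
    rw [if_neg (by lia), if_pos (by lia)]
  · set L := (subcomplexFunctor K (truncSubobject K) (truncSubobject_monotone K)
      (truncSubobject_factors K)).obj n
    have hbot (i : ℤ) (hi : truncSubobject K n.down i = ⊥) : IsZero (L.X i) := by
      change IsZero (truncSubobject K n.down i : C)
      rw [hi]
      exact (isZero_zero C).of_iso Subobject.botCoeIsoZero
    have h1 : L.IsStrictlyGE (-n.down) := (isStrictlyGE_iff _ _).2 fun i hi ↦ hbot i (by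
      unfold truncSubobject
      rw [if_pos hi])
    have h2 : L.IsStrictlyLE n.down := (isStrictlyLE_iff _ _).2 fun i hi ↦ hbot i (by
      unfold truncSubobject
      rw [if_neg (by lia), if_neg (by lia), if_neg (by lia)])
    exact prop_of_isGE_of_isLE P h0 (2 * n.down) (-n.down) n.down _ (by push_cast; lia)
      inferInstance inferInstance

end DerivedCategory

/-! ### Filtered thick classes, subcomodules and quotients -/

namespace AlgGroup

variable {k : Type u} [Field k] {A : Type u} [CommRing A] [HopfAlgebra k A]

/-- The classes of comodules that are closed under isomorphisms, kernels of epimorphisms and extensions,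
and small filtered colimits. -/
structure IsFilteredThick (S : ObjectProperty (Comod k A)) : Prop where
  of_iso {X Y : Comod k A} (e : X ≅ Y) : S X → S Y
  of_ses₁ {T : ShortComplex (Comod k A)} (h : T.ShortExact) : S T.X₂ → S T.X₃ → S T.X₁
  of_ses₂ {T : ShortComplex (Comod k A)} (h : T.ShortExact) : S T.X₁ → S T.X₃ → S T.X₂
  of_colimit (J : Type u) [SmallCategory J] [IsFiltered J] (F : J ⥤ Comod k A) (c : Cocone F)
    (_ : IsColimit c) : (∀ j, S (F.obj j)) → S c.pt

/-- Short exact sequences become distinguished triangles, and placing comodules in degree `0`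
preserves colimits. -/
theorem isFilteredThick_of_isTriangulated (P : ObjectProperty (DGRep k A))
    [P.IsClosedUnderIsomorphisms] [P.IsTriangulated] (hP : IsClosedUnderFilteredColimits P) :
    IsFilteredThick (k := k) (A := A)
      (fun X ↦ P ((DerivedCategory.singleFunctor (Comod k A) 0).obj X)) where
  of_iso e h := P.prop_of_iso ((DerivedCategory.singleFunctor (Comod k A) 0).mapIso e) h
  of_ses₁ h := P.ext_of_isTriangulatedClosed₁ _ h.singleTriangle_distinguished
  of_ses₂ h := P.ext_of_isTriangulatedClosed₂ _ h.singleTriangle_distinguished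
  of_colimit J _ _ F _ hc h := hP J (F ⋙ HomologicalComplex.single _ (.up ℤ) 0) _
    (isColimitOfPreserves (HomologicalComplex.single _ (.up ℤ) 0) hc) h

/-- The regular representation generates as soon as all comodules lie in every filtered thick class
that contains it. -/
theorem generatesUnderFilteredColimits_of_forall
    (h : ∀ S : ObjectProperty (Comod k A), IsFilteredThick S → S (regular k A) → ∀ X, S X) :
    GeneratesUnderFilteredColimits (dgRegular k A) := by
  intro P _ _ hcolim hreg V
  refine DerivedCategory.prop_of_sequential_colimits P (fun F c hc hF ↦ ?_)
    (h _ (isFilteredThick_of_isTriangulated P hcolim) hreg) V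
  have : IsFiltered (ULift.{u} ℕ) := inferInstance
  exact hcolim _ F c hc hF

section Concrete

variable {V W U : Type u} [AddCommGroup V] [Module k V] [AddCommGroup W] [Module k W]
  [AddCommGroup U] [Module k U]

/-- The property of being a right coaction. -/
structure IsCoaction (ρ : V →ₗ[k] V ⊗[k] A) : Prop where
  counit : counitMap k A V ∘ₗ ρ = LinearMap.id
  coassoc : comulMap k A V ∘ₗ ρ = ρ.rTensor A ∘ₗ ρ

/-- The property of commuting with given coactions. -/
def IsColinear (ρ : V →ₗ[k] V ⊗[k] A) (σ : W →ₗ[k] W ⊗[k] A) (f : V →ₗ[k] W) : Prop :=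
  σ ∘ₗ f = f.rTensor A ∘ₗ ρ

/-- The comodule given by a coaction. -/
def Comod.of (ρ : V →ₗ[k] V ⊗[k] A) (h : IsCoaction ρ) : Comod k A where
  A := ModuleCat.of k V
  a := ModuleCat.ofHom ρ
  counit := ModuleCat.hom_ext h.counit
  coassoc := ModuleCat.hom_ext h.coassoc

/-- The morphism of comodules given by a colinear map. -/
def Comod.ofHom {ρ : V →ₗ[k] V ⊗[k] A} {σ : W →ₗ[k] W ⊗[k] A} (hρ : IsCoaction ρ)
    (hσ : IsCoaction σ) (f : V →ₗ[k] W) (hf : IsColinear ρ σ f) :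
    Comod.of ρ hρ ⟶ Comod.of σ hσ where
  f := ModuleCat.ofHom f
  h := ModuleCat.hom_ext hf.symm

theorem Comod.isCoaction (X : Comod k A) :
    IsCoaction (V := X.A) (ModuleCat.Hom.hom X.a) where
  counit := congrArg ModuleCat.Hom.hom X.counit
  coassoc := congrArg ModuleCat.Hom.hom X.coassoc

/-- The coaction `ρ` defines a comodule in the class `S`. -/
def Has (S : ObjectProperty (Comod k A)) (ρ : V →ₗ[k] V ⊗[k] A) : Prop :=
  ∃ h : IsCoaction ρ, S (Comod.of ρ h)

variable {S : ObjectProperty (Comod k A)} {ρ : V →ₗ[k] V ⊗[k] A} {σ : W →ₗ[k] W ⊗[k] A}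
  {τ : U →ₗ[k] U ⊗[k] A}

theorem IsColinear.apply {f : V →ₗ[k] W} (hf : IsColinear ρ σ f) (v : V) :
    σ (f v) = f.rTensor A (ρ v) :=
  LinearMap.congr_fun hf v

theorem Comod.shortExact (hρ : IsCoaction ρ) (hσ : IsCoaction σ) (hτ : IsCoaction τ)
    (f : V →ₗ[k] W) (g : W →ₗ[k] U) (hf : IsColinear ρ σ f) (hg : IsColinear σ τ g)
    (hfi : Function.Injective f) (hgs : Function.Surjective g) (hfg : Function.Exact f g) :
    (ShortComplex.mk (Comod.ofHom hρ hσ f hf) (Comod.ofHom hσ hτ g hg)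
      (by
        apply Comonad.Coalgebra.Hom.ext
        apply ModuleCat.hom_ext
        exact hfg.linearMap_comp_eq_zero)).ShortExact := by
  refine ShortComplex.ShortExact.mk' ?_ ?_ ?_
  · rw [← ShortComplex.exact_map_iff_of_faithful _ (comonad k A).forget]
    rw [ShortComplex.ShortExact.moduleCat_exact_iff_function_exact]
    exact hfg
  · apply (comonad k A).forget.mono_of_mono_map
    exact (ModuleCat.mono_iff_injective _).2 hfi
  · apply (comonad k A).forget.epi_of_epi_map
    exact (ModuleCat.epi_iff_surjective _).2 hgs

theorem Has.of_exact₁ (hS : IsFilteredThick S) (hρ : IsCoaction ρ) (hσ : Has S σ) (hτ : Has S τ)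
    (f : V →ₗ[k] W) (g : W →ₗ[k] U) (hf : IsColinear ρ σ f) (hg : IsColinear σ τ g)
    (hfi : Function.Injective f) (hgs : Function.Surjective g) (hfg : Function.Exact f g) :
    Has S ρ :=
  ⟨hρ, hS.of_ses₁ (Comod.shortExact hρ hσ.1 hτ.1 f g hf hg hfi hgs hfg) hσ.2 hτ.2⟩

theorem Has.of_exact₂ (hS : IsFilteredThick S) (hρ : Has S ρ) (hσ : IsCoaction σ) (hτ : Has S τ)
    (f : V →ₗ[k] W) (g : W →ₗ[k] U) (hf : IsColinear ρ σ f) (hg : IsColinear σ τ g)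
    (hfi : Function.Injective f) (hgs : Function.Surjective g) (hfg : Function.Exact f g) :
    Has S σ :=
  ⟨hσ, hS.of_ses₂ (Comod.shortExact hρ.1 hσ hτ.1 f g hf hg hfi hgs hfg) hρ.2 hτ.2⟩

theorem Has.of_linearEquiv (hS : IsFilteredThick S) (hρ : Has S ρ) (hσ : IsCoaction σ)
    (e : V ≃ₗ[k] W) (he : IsColinear ρ σ e.toLinearMap) : Has S σ := by
  refine ⟨hσ, hS.of_iso ?_ hρ.2⟩
  have : IsIso ((comonad k A).forget.map (Comod.ofHom hρ.1 hσ e.toLinearMap he)) :=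
    inferInstanceAs (IsIso e.toModuleIso.hom)
  have := isIso_of_reflects_iso (Comod.ofHom hρ.1 hσ e.toLinearMap he) (comonad k A).forget
  exact asIso (Comod.ofHom hρ.1 hσ e.toLinearMap he)

/-- A retract is the colimit of the sequence `Z → Z → ⋯` whose transition maps are the idempotent `r
≫ i`. -/
theorem IsFilteredThick.of_retract (hS : IsFilteredThick S) {X Z : Comod k A} (i : X ⟶ Z)
    (r : Z ⟶ X) (h : i ≫ r = 𝟙 X) (hZ : S Z) : S X := by
  have he : (r ≫ i) ≫ r ≫ i = r ≫ i := by simp [reassoc_of% h]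
  let F : ULift.{u} ℕ ⥤ Comod k A :=
    { obj _ := Z
      map {m n} _ := if m = n then 𝟙 Z else r ≫ i
      map_id _ := if_pos rfl
      map_comp {l m n} f g := by
        have hf : l ≤ m := leOfHom f
        have hg : m ≤ n := leOfHom g
        by_cases h1 : l = m
        · subst h1; simp
        by_cases h2 : m = n
        · subst h2; simp
        have h3 : l ≠ n := by
          rintro rfl
          exact h1 (le_antisymm hf hg)
        rw [if_neg h1, if_neg h2, if_neg h3, he] }
  let c : Cocone F :=
    { pt := X
      ι :=
        { app _ := r
          naturality m n f := by
            by_cases h1 : m = n <;> simp [F, h1, h] } }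
  -- Stages `0` and `n` are compared at stage `n + 1`, as the idempotent only appears on arrows to a
  -- strictly later stage.
  have hw (t : Cocone F) (n : ULift.{u} ℕ) : r ≫ i ≫ t.ι.app ⟨0⟩ = t.ι.app n := by
    have h1 (m : ULift.{u} ℕ) (hm : m.down < n.down + 1) :
        (r ≫ i) ≫ t.ι.app ⟨n.down + 1⟩ = t.ι.app m := by
      rw [← t.w (homOfLE hm.le : m ⟶ ⟨n.down + 1⟩)]
      have : m ≠ ⟨n.down + 1⟩ := by
        rintro rfl
        exact lt_irrefl _ hm
      simp [F, this]
    rw [← h1 ⟨0⟩ (by simp), ← h1 n (by simp), ← Category.assoc, ← Category.assoc, he]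
  refine hS.of_colimit (ULift.{u} ℕ) F c
    { desc t := i ≫ t.ι.app ⟨0⟩
      fac t n := hw t n
      uniq t m hm := ?_ } fun _ ↦ hZ
  rw [← hm ⟨0⟩, reassoc_of% h]

theorem Has.of_retract (hS : IsFilteredThick S) (hρ : IsCoaction ρ) (hσ : Has S σ)
    (i : V →ₗ[k] W) (r : W →ₗ[k] V) (hi : IsColinear ρ σ i) (hr : IsColinear σ ρ r)
    (h : r ∘ₗ i = LinearMap.id) : Has S ρ :=
  ⟨hρ, hS.of_retract (Comod.ofHom hρ hσ.1 i hi) (Comod.ofHom hσ.1 hρ r hr)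
    (Comonad.Coalgebra.Hom.ext (ModuleCat.hom_ext h)) hσ.2⟩

/-- The axioms hold after applying `f`, respectively `f ⊗ A ⊗ A`, which is still injective by
flatness over `k`. Subcomodules inherit the axioms in this way, and quotients by the dual argument
below. -/
theorem IsCoaction.of_injective (hσ : IsCoaction σ) {f : V →ₗ[k] W} (hf : IsColinear ρ σ f)
    (hi : Function.Injective f) : IsCoaction ρ where
  counit := by
    rw [← LinearMap.cancel_left hi, ← LinearMap.comp_assoc, ← counitMap_naturality,
      LinearMap.comp_assoc, ← hf, ← LinearMap.comp_assoc, hσ.counit, LinearMap.comp_id,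
      LinearMap.id_comp]
  coassoc := by
    have hi2 : Function.Injective ((f.rTensor A).rTensor A) :=
      Module.Flat.rTensor_preserves_injective_linearMap _
        (Module.Flat.rTensor_preserves_injective_linearMap _ hi)
    rw [← LinearMap.cancel_left hi2, ← LinearMap.comp_assoc, ← comulMap_naturality,
      LinearMap.comp_assoc, ← hf, ← LinearMap.comp_assoc, hσ.coassoc, LinearMap.comp_assoc, hf,
      ← LinearMap.comp_assoc, ← LinearMap.comp_assoc, ← LinearMap.rTensor_comp, hf,
      LinearMap.rTensor_comp]

theorem IsCoaction.of_surjective (hρ : IsCoaction ρ) {f : V →ₗ[k] W} (hf : IsColinear ρ σ f)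
    (hs : Function.Surjective f) : IsCoaction σ where
  counit := by
    rw [← LinearMap.cancel_right hs, LinearMap.comp_assoc, hf, ← LinearMap.comp_assoc,
      counitMap_naturality, LinearMap.comp_assoc, hρ.counit, LinearMap.comp_id, LinearMap.id_comp]
  coassoc := by
    rw [← LinearMap.cancel_right hs, LinearMap.comp_assoc, hf, ← LinearMap.comp_assoc,
      comulMap_naturality, LinearMap.comp_assoc, hρ.coassoc, LinearMap.comp_assoc, hf,
      ← LinearMap.comp_assoc, ← LinearMap.comp_assoc, ← LinearMap.rTensor_comp,
      ← LinearMap.rTensor_comp, hf]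

theorem IsColinear.comp {f : V →ₗ[k] W} {g : W →ₗ[k] U} (hg : IsColinear σ τ g)
    (hf : IsColinear ρ σ f) : IsColinear ρ τ (g ∘ₗ f) := by
  rw [IsColinear, ← LinearMap.comp_assoc, hg, LinearMap.comp_assoc, hf, ← LinearMap.comp_assoc,
    LinearMap.rTensor_comp]

/-- The property of being a subcomodule. -/
def IsStable (ρ : V →ₗ[k] V ⊗[k] A) (M : Submodule k V) : Prop :=
  ∀ m ∈ M, M.mkQ.rTensor A (ρ m) = 0

theorem isStable_iff {M : Submodule k V} :
    IsStable ρ M ↔ ∀ m ∈ M, ρ m ∈ LinearMap.range (M.subtype.rTensor A) := by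
  have h := rTensor_exact A (LinearMap.exact_subtype_mkQ M) M.mkQ_surjective
  exact forall₂_congr fun m _ ↦ h (ρ m)

/-- The coaction on a subcomodule. -/
def restrict (ρ : V →ₗ[k] V ⊗[k] A) (M : Submodule k V) (hM : IsStable ρ M) : M →ₗ[k] M ⊗[k] A :=
  (LinearEquiv.ofInjective (M.subtype.rTensor A)
    (Module.Flat.rTensor_preserves_injective_linearMap _ M.injective_subtype)).symm.toLinearMap ∘ₗ
      (ρ ∘ₗ M.subtype).codRestrict _ fun m ↦ isStable_iff.1 hM m m.2

/-- The coaction on the quotient by a subcomodule. -/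
def quot (ρ : V →ₗ[k] V ⊗[k] A) (M : Submodule k V) (hM : IsStable ρ M) :
    V ⧸ M →ₗ[k] (V ⧸ M) ⊗[k] A :=
  M.liftQ (M.mkQ.rTensor A ∘ₗ ρ) hM

theorem isColinear_subtype (M : Submodule k V) (hM : IsStable ρ M) :
    IsColinear (restrict ρ M hM) ρ M.subtype := by
  ext m
  have := LinearEquiv.apply_symm_apply (LinearEquiv.ofInjective (M.subtype.rTensor A)
    (Module.Flat.rTensor_preserves_injective_linearMap _ M.injective_subtype))
    (((ρ ∘ₗ M.subtype).codRestrict _ fun m ↦ isStable_iff.1 hM m m.2) m)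
  exact (congrArg Subtype.val this).symm

theorem isColinear_mkQ (M : Submodule k V) (hM : IsStable ρ M) :
    IsColinear ρ (quot ρ M hM) M.mkQ := by
  ext m
  rfl

theorem IsCoaction.restrict (hρ : IsCoaction ρ) (M : Submodule k V) (hM : IsStable ρ M) :
    IsCoaction (restrict ρ M hM) :=
  hρ.of_injective (isColinear_subtype M hM) M.injective_subtype

theorem IsCoaction.quot (hρ : IsCoaction ρ) (M : Submodule k V) (hM : IsStable ρ M) :
    IsCoaction (quot ρ M hM) :=
  hρ.of_surjective (isColinear_mkQ M hM) M.mkQ_surjective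

theorem IsColinear.codRestrict {f : V →ₗ[k] W} (hf : IsColinear ρ σ f) (M : Submodule k W)
    (hM : IsStable σ M) (h : ∀ v, f v ∈ M) : IsColinear ρ (AlgGroup.restrict σ M hM)
      (f.codRestrict M h) := by
  have hi : Function.Injective (M.subtype.rTensor A) :=
    Module.Flat.rTensor_preserves_injective_linearMap _ M.injective_subtype
  rw [IsColinear, ← LinearMap.cancel_left hi, ← LinearMap.comp_assoc, ← isColinear_subtype M hM,
    ← LinearMap.comp_assoc, ← LinearMap.rTensor_comp, LinearMap.comp_assoc,
    LinearMap.subtype_comp_codRestrict, hf]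

theorem isStable_of_isColinear_of_forall_mem {f : V →ₗ[k] W} (hf : IsColinear ρ σ f)
    {M : Submodule k W} (hM : ∀ v, f v ∈ M) (v : V) : M.mkQ.rTensor A (σ (f v)) = 0 := by
  rw [hf.apply, ← LinearMap.comp_apply, ← LinearMap.rTensor_comp,
    show M.mkQ ∘ₗ f = 0 by ext v; simpa using hM v, LinearMap.rTensor_zero, LinearMap.zero_apply]

theorem isStable_range {f : V →ₗ[k] W} (hf : IsColinear ρ σ f) :
    IsStable σ (LinearMap.range f) := by
  rintro _ ⟨v, rfl⟩
  exact isStable_of_isColinear_of_forall_mem hf (fun v ↦ LinearMap.mem_range_self f v) v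

theorem rTensor_mkQ_eq_zero_of_le {M N : Submodule k V} (h : M ≤ N) {x : V ⊗[k] A}
    (hx : M.mkQ.rTensor A x = 0) : N.mkQ.rTensor A x = 0 := by
  have : N.mkQ = M.factor h ∘ₗ M.mkQ := by ext; rfl
  rw [this, LinearMap.rTensor_comp, LinearMap.comp_apply, hx, map_zero]

theorem isStable_iSup {ι : Sort*} {M : ι → Submodule k V} (h : ∀ i, IsStable ρ (M i)) :
    IsStable ρ (⨆ i, M i) := by
  intro m hm
  have : (⨆ i, M i) ≤ LinearMap.ker ((⨆ i, M i).mkQ.rTensor A ∘ₗ ρ) :=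
    iSup_le fun i m hm ↦ rTensor_mkQ_eq_zero_of_le (le_iSup M i) (h i m hm)
  exact this hm

theorem IsStable.sup {M N : Submodule k V} (hM : IsStable ρ M) (hN : IsStable ρ N) :
    IsStable ρ (M ⊔ N) := by
  rw [sup_eq_iSup]
  exact isStable_iSup fun b ↦ by cases b <;> assumption

/-- `V ⧸ f⁻¹(M)` embeds into `W ⧸ M`, and this embedding survives tensoring with the flat module
`A`, so stability can be tested there. -/
theorem IsStable.comap {f : V →ₗ[k] W} (hf : IsColinear ρ σ f) {M : Submodule k W}
    (hM : IsStable σ M) : IsStable ρ (M.comap f) := by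
  intro v hv
  let g : V ⧸ M.comap f →ₗ[k] W ⧸ M := (M.comap f).mapQ M f le_rfl
  have hg : Function.Injective g := by
    rw [← LinearMap.ker_eq_bot, Submodule.ker_mapQ]
    simp
  refine Module.Flat.rTensor_preserves_injective_linearMap (M := A) g hg ?_
  rw [map_zero, ← LinearMap.comp_apply, ← LinearMap.rTensor_comp,
    show g ∘ₗ (M.comap f).mkQ = M.mkQ ∘ₗ f by ext; rfl, LinearMap.rTensor_comp,
    LinearMap.comp_apply, ← hf.apply]
  exact hM _ hv

/-- A comodule that is a directed union of subcomodules in the class `S` is in the class `S`. -/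
theorem Has.of_directed_union (hS : IsFilteredThick S) (hρ : IsCoaction ρ) {ι : Type u}
    [Preorder ι] [IsDirectedOrder ι] [Nonempty ι] (M : ι → Submodule k V) (hM : Monotone M)
    (hst : ∀ i, IsStable ρ (M i)) (hsup : ∀ v, ∃ i, v ∈ M i)
    (h : ∀ i, Has S (AlgGroup.restrict ρ (M i) (hst i))) : Has S ρ := by
  let F : ι ⥤ Comod k A :=
    { obj i := Comod.of _ (hρ.restrict (M i) (hst i))
      map {i j} f := Comod.ofHom _ _ (Submodule.inclusion (hM (leOfHom f)))
        ((isColinear_subtype (M i) (hst i)).codRestrict (M j) (hst j)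
          fun v ↦ hM (leOfHom f) v.2)
      map_id i := rfl
      map_comp f g := rfl }
  let c : Cocone F :=
    { pt := Comod.of ρ hρ
      ι :=
        { app i := Comod.ofHom (hρ.restrict (M i) (hst i)) hρ (M i).subtype
            (isColinear_subtype (M i) (hst i)) } }
  -- The forgetful functors to vector spaces and to sets reflect this colimit, so it can be checked
  -- on elements.
  have hc : IsColimit ((forget (ModuleCat k)).mapCocone ((comonad k A).forget.mapCocone c)) := by
    refine Types.FilteredColimit.isColimitOf _ _ (fun x ↦ ?_) fun i j x y hxy ↦ ?_
    · obtain ⟨i, hi⟩ := hsup x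
      exact ⟨i, ⟨x, hi⟩, rfl⟩
    · obtain ⟨l, hil, hjl⟩ := exists_ge_ge i j
      exact ⟨l, homOfLE hil, homOfLE hjl, Subtype.ext hxy⟩
  have hc2 : IsColimit ((comonad k A).forget.mapCocone c) :=
    isColimitOfReflects (forget (ModuleCat k)) hc
  exact ⟨hρ, hS.of_colimit ι F c (isColimitOfReflects (comonad k A).forget hc2) fun i ↦ (h i).2⟩

end Concrete
end AlgGroup

/-! ### Sums of images and cofree comodules -/

namespace AlgGroup

variable {k : Type u} [Field k] {A : Type u} [CommRing A] [HopfAlgebra k A]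

variable {V W U : Type u} [AddCommGroup V] [Module k V] [AddCommGroup W] [Module k W]
  [AddCommGroup U] [Module k U]
  {S : ObjectProperty (Comod k A)} {ρ : V →ₗ[k] V ⊗[k] A} {σ : W →ₗ[k] W ⊗[k] A}
  {τ : U →ₗ[k] U ⊗[k] A}

/-- A subcomodule `N` is obtained from a subcomodule `M` by adding the image of a colinear map `f`. -/
theorem Has.sup_range (hS : IsFilteredThick S) (hσ : IsCoaction σ)
    {M N : Submodule k W} (hM : IsStable σ M) (hN : IsStable σ N)
    (h : Has S (restrict σ M hM)) {f : V →ₗ[k] W} (hf : IsColinear ρ σ f)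
    (hMN : N = M ⊔ LinearMap.range f) (hq : Has S (quot ρ (M.comap f) (hM.comap hf))) :
    Has S (restrict σ N hN) := by
  have hle : M ≤ N := hMN ▸ le_sup_left
  have hfN (v : V) : f v ∈ N := hMN ▸ Submodule.mem_sup_right ⟨v, rfl⟩
  have hic : IsColinear (restrict σ M hM) (restrict σ N hN) (Submodule.inclusion hle) :=
    (isColinear_subtype M hM).codRestrict N hN fun v ↦ hle v.2
  set L : Submodule k N := LinearMap.range (Submodule.inclusion hle)
  have hL : IsStable (restrict σ N hN) L := isStable_range hic
  set f' : V →ₗ[k] N := f.codRestrict N hfN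
  have hf' : IsColinear ρ (restrict σ N hN) f' := hf.codRestrict N hN hfN
  have hcomap : M.comap f = L.comap f' := by
    ext v
    constructor
    · intro hv
      exact ⟨⟨f v, hv⟩, rfl⟩
    · rintro ⟨m, hm⟩
      have : (m : W) = f v := congrArg Subtype.val hm
      rw [Submodule.mem_comap, ← this]
      exact m.2
  -- This is the isomorphism `V ⧸ f⁻¹(M) ≅ N ⧸ M`, with `L` the copy of `M` inside `N`; it presents
  -- `N` as an extension of members of `S`.
  let e : (V ⧸ M.comap f) →ₗ[k] N ⧸ L := (M.comap f).mapQ L f' hcomap.le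
  have he : Function.Bijective e := by
    constructor
    · rw [← LinearMap.ker_eq_bot, Submodule.ker_mapQ, ← hcomap]
      simp
    · intro x
      obtain ⟨⟨n, hn⟩, rfl⟩ := L.mkQ_surjective x
      obtain ⟨m, hm, _, ⟨v, rfl⟩, hmv⟩ := Submodule.mem_sup.1 (hMN ▸ hn)
      refine ⟨Submodule.Quotient.mk v, (Submodule.Quotient.eq L).2 ?_⟩
      refine ⟨⟨-m, neg_mem hm⟩, Subtype.ext ?_⟩
      change -m = f v - n
      rw [← hmv]
      abel
  have hec : IsColinear (quot ρ (M.comap f) (hM.comap hf)) (quot (restrict σ N hN) L hL) e := by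
    rw [IsColinear, ← LinearMap.cancel_right (M.comap f).mkQ_surjective, LinearMap.comp_assoc,
      LinearMap.comp_assoc, isColinear_mkQ, ← LinearMap.comp_assoc _ _ (LinearMap.rTensor A e),
      ← LinearMap.rTensor_comp, show e ∘ₗ (M.comap f).mkQ = L.mkQ ∘ₗ f' by ext; rfl]
    exact (isColinear_mkQ L hL).comp hf'
  have hquot : Has S (quot (restrict σ N hN) L hL) :=
    hq.of_linearEquiv hS ((hσ.restrict N hN).quot L hL) (LinearEquiv.ofBijective e he) hec
  exact h.of_exact₂ hS (hσ.restrict N hN) hquot (Submodule.inclusion hle) L.mkQ hic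
    (isColinear_mkQ L hL) (Submodule.inclusion_injective hle) L.mkQ_surjective
    (LinearMap.exact_map_mkQ_range _)

theorem Has.of_subsingleton (hS : IsFilteredThick S) (hσ : Has S σ) [Subsingleton V]
    (hρ : IsCoaction ρ) : Has S ρ :=
  hσ.of_retract hS hρ 0 0 (by simp [IsColinear]) (by simp [IsColinear])
    (by ext v; exact Subsingleton.elim _ _)

/-- A comodule that is the sum of images of colinear maps is in the class `S` as soon as all the
successive quotients are. -/
theorem Has.of_sum_range (hS : IsFilteredThick S) (hσ : IsCoaction σ) (hτ : Has S τ) {ι : Type u}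
    (f : ι → V →ₗ[k] W) (hf : ∀ i, IsColinear ρ σ (f i))
    (hsup : ⨆ i, LinearMap.range (f i) = ⊤)
    (hq : ∀ (s : Finset ι) (i : ι) (h : IsStable ρ ((⨆ j ∈ s, LinearMap.range (f j)).comap (f i))),
      i ∉ s → Has S (quot ρ _ h)) : Has S σ := by
  classical
  have hst (s : Finset ι) : IsStable σ (⨆ j ∈ s, LinearMap.range (f j)) :=
    isStable_iSup fun j ↦ isStable_iSup fun _ ↦ isStable_range (hf j)
  have hmono : Monotone fun s : Finset ι ↦ ⨆ j ∈ s, LinearMap.range (f j) :=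
    fun s t h ↦ biSup_mono h
  refine Has.of_directed_union hS hσ (fun s : Finset ι ↦ ⨆ j ∈ s, LinearMap.range (f j)) hmono hst
    (fun w ↦ ?_) fun s ↦ ?_
  · have hw : w ∈ ⨆ i, LinearMap.range (f i) := hsup ▸ Submodule.mem_top
    rw [iSup_eq_iSup_finset] at hw
    exact (Submodule.mem_iSup_of_directed _ hmono.directed_le).1 hw
  · induction s using Finset.induction_on with
    | empty =>
      have : Subsingleton (⨆ j ∈ (∅ : Finset ι), LinearMap.range (f j) : Submodule k W) := by
        simp only [Finset.notMem_empty, iSup_false, iSup_bot]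
        infer_instance
      -- `hτ` only supplies some member of `S`, of which the zero comodule is a retract.
      exact hτ.of_subsingleton hS (hσ.restrict _ _)
    | insert i s hi ih =>
      exact Has.sup_range hS hσ (hst s) _ ih (hf i)
        (by rw [Finset.iSup_insert, sup_comm]) (hq s i _ hi)

theorem isCoaction_comulMap (V : Type u) [AddCommGroup V] [Module k V] :
    IsCoaction (comulMap k A V) where
  counit := counitMap_left k A V
  coassoc := (comulMap_coassoc k A V).symm

theorem isCoaction_comul : IsCoaction (Coalgebra.comul (R := k) (A := A)) :=
  Comod.isCoaction (regular k A)

theorem comulMap_tmul (v : V) (a : A) :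
    comulMap k A V (v ⊗ₜ a) = (TensorProduct.mk k V A v).rTensor A (Coalgebra.comul (R := k) a) := by
  simp only [comulMap, LinearMap.comp_apply, LinearMap.lTensor_tmul, LinearEquiv.coe_coe]
  induction Coalgebra.comul (R := k) a with
  | zero => simp
  | tmul x y => simp
  | add x y hx hy => simp only [TensorProduct.tmul_add, map_add, hx, hy]

theorem isColinear_mk (v : V) :
    IsColinear (Coalgebra.comul (R := k) (A := A)) (comulMap k A V) (TensorProduct.mk k V A v) := by
  ext a
  exact comulMap_tmul v a

/-- A basis of `V` makes the cofree comodule `V ⊗ A` a direct sum of copies of `A`. Each new copy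
meets the sum of the previous ones in `0`, so the successive quotients are all `A`. -/
theorem has_comulMap (hS : IsFilteredThick S) (hA : S (regular k A)) (V : Type u) [AddCommGroup V]
    [Module k V] : Has S (comulMap k A V) := by
  have hreg : Has S (Coalgebra.comul (R := k) (A := A)) := ⟨isCoaction_comul, hA⟩
  let b := Module.Basis.ofVectorSpace k V
  refine Has.of_sum_range hS (isCoaction_comulMap V) hreg (fun i ↦ TensorProduct.mk k V A (b i))
    (fun i ↦ isColinear_mk (b i)) ?_ fun s i h hi ↦ ?_
  · rw [eq_top_iff, ← TensorProduct.span_tmul_eq_top, Submodule.span_le]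
    rintro _ ⟨v, a, rfl⟩
    have : Submodule.span k (Set.range b) ≤ (⨆ i, LinearMap.range
        (TensorProduct.mk k V A (b i))).comap ((TensorProduct.mk k V A).flip a) := by
      rw [Submodule.span_le]
      rintro _ ⟨i, rfl⟩
      exact Submodule.mem_iSup_of_mem i ⟨a, rfl⟩
    exact this (b.mem_span v)
  · have hbot : (⨆ j ∈ s, LinearMap.range (TensorProduct.mk k V A (b j))).comap
        (TensorProduct.mk k V A (b i)) = ⊥ := by
      rw [eq_bot_iff]
      intro a ha
      let g : V ⊗[k] A →ₗ[k] A := (TensorProduct.lid k A).toLinearMap ∘ₗ (b.coord i).rTensor A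
      have hg : (⨆ j ∈ s, LinearMap.range (TensorProduct.mk k V A (b j))) ≤ LinearMap.ker g := by
        refine iSup₂_le fun j hj ↦ ?_
        rintro _ ⟨a, rfl⟩
        have : j ≠ i := by rintro rfl; exact hi hj
        simp [g, this]
      simpa [g] using hg ha
    have hinj : LinearMap.ker (Submodule.mkQ _) = ⊥ := (Submodule.ker_mkQ _).trans hbot
    exact hreg.of_linearEquiv hS (isCoaction_comul.quot _ _)
      (LinearEquiv.ofBijective (Submodule.mkQ _)
        ⟨LinearMap.ker_eq_bot.1 hinj, Submodule.mkQ_surjective _⟩) (isColinear_mkQ _ _)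

end AlgGroup

/-! ### Stable submodules of a module generated by colinear orbits -/

namespace AlgGroup

variable {k : Type u} [Field k] {A : Type u} [CommRing A] [HopfAlgebra k A]
  {V W U : Type u} [AddCommGroup V] [Module k V] [AddCommGroup W] [Module k W]
  [AddCommGroup U] [Module k U]
  {S : ObjectProperty (Comod k A)} {ρ : V →ₗ[k] V ⊗[k] A} {σ : W →ₗ[k] W ⊗[k] A}
  {τ : U →ₗ[k] U ⊗[k] A}

/-- A direct summand of a comodule in the class `S` is in the class `S`. -/
theorem Has.of_coprod_bijective (hS : IsFilteredThick S) (hρ : IsCoaction ρ) (hσ : Has S σ)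
    (i : V →ₗ[k] W) (j : U →ₗ[k] W) (hi : IsColinear ρ σ i) (hj : IsColinear τ σ j)
    (h : Function.Bijective (i.coprod j)) : Has S ρ := by
  let e := LinearEquiv.ofBijective (i.coprod j) h
  let r : W →ₗ[k] V := LinearMap.fst k V U ∘ₗ e.symm.toLinearMap
  have hri : r ∘ₗ i = LinearMap.id := by
    ext v
    have : e.symm (i v) = (v, 0) := e.symm_apply_eq.2 (by simp [e])
    simp [r, this]
  have hrj : r ∘ₗ j = 0 := by
    ext v
    have : e.symm (j v) = (0, v) := e.symm_apply_eq.2 (by simp [e])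
    simp [r, this]
  refine hσ.of_retract hS hρ i r hi ?_ hri
  clear_value r
  -- Colinearity of the projection is checked on the two summands separately.
  rw [IsColinear, ← LinearMap.cancel_right h.2]
  apply LinearMap.prod_ext
  · rw [LinearMap.comp_assoc, LinearMap.comp_assoc, LinearMap.comp_assoc, LinearMap.comp_assoc,
      LinearMap.coprod_inl, hri, hi, ← LinearMap.comp_assoc ρ, ← LinearMap.rTensor_comp, hri]
    simp
  · rw [LinearMap.comp_assoc, LinearMap.comp_assoc, LinearMap.comp_assoc, LinearMap.comp_assoc,
      LinearMap.coprod_inr, hrj, hj, ← LinearMap.comp_assoc τ, ← LinearMap.rTensor_comp, hrj]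
    simp

/-- If a direct sum of two subcomodules lies in the class `S`, then so does each of them. -/
theorem Has.restrict_of_disjoint (hS : IsFilteredThick S) (hσ : IsCoaction σ) {M L F : Submodule k W}
    (hM : IsStable σ M) (hL : IsStable σ L) (hF : IsStable σ F) (h : Has S (restrict σ F hF))
    (hML : Disjoint L M) (hsup : F = M ⊔ L) : Has S (restrict σ M hM) := by
  have hMF : M ≤ F := hsup ▸ le_sup_left
  have hLF : L ≤ F := hsup ▸ le_sup_right
  refine Has.of_coprod_bijective hS (hσ.restrict _ hM) h (Submodule.inclusion hMF)
    (Submodule.inclusion hLF) ((isColinear_subtype _ hM).codRestrict _ hF fun m ↦ hMF m.2)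
    ((isColinear_subtype _ hL).codRestrict _ hF fun m ↦ hLF m.2) ⟨?_, ?_⟩
  · rw [← LinearMap.ker_eq_bot, LinearMap.ker_eq_bot']
    rintro ⟨⟨m, hm⟩, ⟨l, hl⟩⟩ h
    have h1 : m + l = 0 := congrArg Subtype.val h
    have h2 : l ∈ M := by
      rw [eq_neg_of_add_eq_zero_right h1]
      exact neg_mem hm
    have h3 := Submodule.disjoint_def.1 hML l hl h2
    subst h3
    rw [add_zero] at h1
    subst h1
    rfl
  · rintro ⟨x, hx⟩
    obtain ⟨m, hm, l, hl, rfl⟩ := Submodule.mem_sup.1 (hsup ▸ hx)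
    exact ⟨(⟨m, hm⟩, ⟨l, hl⟩), rfl⟩

variable {B : Type u} [CommRing B] [Algebra k B] {β : B →ₗ[k] B ⊗[k] A}
  {N : Type u} [AddCommGroup N] [Module k N] [Module B N] [IsScalarTower k B N]
  {ν : N →ₗ[k] N ⊗[k] A}

/-- The map `b ↦ b • e`. -/
abbrev orbitMap (k : Type u) [Field k] (B : Type u) [CommRing B] [Algebra k B] {N : Type u}
    [AddCommGroup N] [Module k N] [Module B N] [IsScalarTower k B N] (e : N) : B →ₗ[k] N :=
  (LinearMap.toSpanSingleton B N e).restrictScalars k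

theorem exists_maximal_stable_disjoint (M : Submodule B N) :
    ∃ L : Submodule B N, Maximal (fun L ↦ IsStable ν (L.restrictScalars k) ∧ Disjoint L M) L := by
  refine zorn_le₀ {L : Submodule B N | IsStable ν (L.restrictScalars k) ∧ Disjoint L M}
    fun c hc hchain ↦ ?_
  refine ⟨sSup c, ⟨?_, ?_⟩, fun z hz ↦ le_sSup hz⟩
  · rw [Submodule.restrictScalars_sSup, sSup_image]
    exact isStable_iSup fun L ↦ isStable_iSup fun hL ↦ (hc hL).1
  · exact (hchain.directedOn.disjoint_sSup_left).2 fun L hL ↦ (hc hL).2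

theorem range_mkQ_comp_orbitMap (F : Submodule B N) (e : N) :
    LinearMap.range ((F.restrictScalars k).mkQ ∘ₗ orbitMap k B e) =
      ((Submodule.span B {e}).restrictScalars k).map (F.restrictScalars k).mkQ := by
  rw [LinearMap.range_comp, ← LinearMap.range_toSpanSingleton]
  rfl

/-- Identifies the successive quotients that `Has.of_sum_range` requires for `N ⧸ F` with quotients
of `B` by ideals. -/
theorem comap_iSup_range_mkQ_comp_orbitMap (F : Submodule B N) {γ : Type*} (e : γ → N)
    (s : Finset γ) (e' : N) :
    (⨆ j ∈ s, LinearMap.range ((F.restrictScalars k).mkQ ∘ₗ orbitMap k B (e j))).comap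
      ((F.restrictScalars k).mkQ ∘ₗ orbitMap k B e') =
    Submodule.restrictScalars k ((F ⊔ ⨆ j ∈ s, Submodule.span B {e j}).comap
      (LinearMap.toSpanSingleton B N e')) := by
  simp_rw [range_mkQ_comp_orbitMap, ← Submodule.map_iSup, ← Submodule.restrictScalars_iSup]
  rw [Submodule.comap_comp, Submodule.comap_map_mkQ, ← Submodule.restrictScalars_sup]
  rfl

/-- Let `J` be the ideal of all `b` with `b • e ∈ F`. If `J ≤ I`, then `L + B e` is still disjoint
from `M`: `l + b • e ∈ M` gives `b ∈ J ≤ I`, hence `b • e = 0` and `l ∈ L ∩ M = 0`. Maximality of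
`L` then forces `e ∈ L`. -/
theorem lt_comap_toSpanSingleton_of_maximal {M L : Submodule B N}
    (hmax : Maximal (fun L ↦ IsStable ν (L.restrictScalars k) ∧ Disjoint L M) L) {e : N}
    (he : IsColinear β ν (orbitMap k B e)) (I : Ideal B) (hI : ∀ b ∈ I, ∀ n : N, b • n = 0)
    (heL : e ∉ L) (F : Submodule B N) (hF : M ⊔ L ≤ F) :
    I < F.comap (LinearMap.toSpanSingleton B N e) := by
  refine lt_of_le_not_ge (fun b hb ↦ ?_) fun hJI ↦ heL ?_
  · rw [Submodule.mem_comap, LinearMap.toSpanSingleton_apply, hI b hb]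
    exact zero_mem _
  have hrange : LinearMap.range (orbitMap k B e) = (Submodule.span B {e}).restrictScalars k := by
    rw [← LinearMap.range_toSpanSingleton]
    rfl
  have hst : IsStable ν ((L ⊔ Submodule.span B {e}).restrictScalars k) := by
    rw [Submodule.restrictScalars_sup, ← hrange]
    exact hmax.1.1.sup (isStable_range he)
  have hdis : Disjoint (L ⊔ Submodule.span B {e}) M := by
    rw [Submodule.disjoint_def]
    intro x hx hxM
    obtain ⟨l, hl, y, hy, rfl⟩ := Submodule.mem_sup.1 hx
    obtain ⟨b, rfl⟩ := Submodule.mem_span_singleton.1 hy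
    have hb : b ∈ F.comap (LinearMap.toSpanSingleton B N e) := by
      rw [Submodule.mem_comap, LinearMap.toSpanSingleton_apply]
      apply hF
      rw [← add_sub_cancel_left l (b • e)]
      exact sub_mem (Submodule.mem_sup_left hxM) (Submodule.mem_sup_right hl)
    rw [hI b (hJI hb), add_zero] at hxM ⊢
    exact Submodule.disjoint_def.1 hmax.1.2 l hl hxM
  exact hmax.2 ⟨hst, hdis⟩ le_sup_left
    (Submodule.mem_sup_right (Submodule.mem_span_singleton_self _))

theorem Has.quot_congr {X Y : Submodule k V} (hX : IsStable ρ X) (hY : IsStable ρ Y) (h : X = Y)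
    (hq : Has S (quot ρ Y hY)) : Has S (quot ρ X hX) := by
  subst h
  exact hq

/-- Let `N` be a comodule and a `B`-module that is generated by elements `e` such that `b ↦ b • e` is
colinear and that is killed by a subcomodule ideal `I` of `B`. If `N` and all `B ⧸ J` with `I < J`
lie in the class `S`, then so does every `B`-submodule of `N` that is a subcomodule. -/
theorem Has.restrict_of_span_eq_top (hS : IsFilteredThick S) (hβ : IsCoaction β) (hν : Has S ν)
    {γ : Type u} (e : γ → N) (he : ∀ i, IsColinear β ν (orbitMap k B (e i)))
    (hspan : Submodule.span B (Set.range e) = ⊤) (I : Ideal B) (hI : ∀ b ∈ I, ∀ n : N, b • n = 0)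
    (hJ : ∀ (J : Ideal B) (h : IsStable β (J.restrictScalars k)), I < J → Has S (quot β _ h))
    (M : Submodule B N) (hM : IsStable ν (M.restrictScalars k)) :
    Has S (restrict ν (M.restrictScalars k) hM) := by
  obtain ⟨L, hmax⟩ := exists_maximal_stable_disjoint (ν := ν) M
  obtain ⟨hL, hLM⟩ := hmax.1
  have hF : IsStable ν ((M ⊔ L).restrictScalars k) := by
    rw [Submodule.restrictScalars_sup]
    exact hM.sup hL
  have hT : Has S (quot ν _ hF) := by
    refine Has.of_sum_range hS (hν.1.quot _ hF) hν
      (fun i ↦ ((M ⊔ L).restrictScalars k).mkQ ∘ₗ orbitMap k B (e i))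
      (fun i ↦ (isColinear_mkQ _ hF).comp (he i)) ?_ fun s i h _ ↦ ?_
    · simp_rw [range_mkQ_comp_orbitMap]
      rw [← Submodule.map_iSup, ← Submodule.restrictScalars_iSup, ← Submodule.span_range_eq_iSup,
        hspan, Submodule.restrictScalars_top, Submodule.map_top, Submodule.range_mkQ]
    · have hJeq := comap_iSup_range_mkQ_comp_orbitMap (k := k) (M ⊔ L) e s (e i)
      refine Has.quot_congr h (hJeq ▸ h) hJeq ?_
      -- A generator in `L` contributes nothing to the quotient; any other contributes some `B ⧸ J`
      -- with `I < J`.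
      by_cases hei : e i ∈ L
      · have : Subsingleton (B ⧸ Submodule.restrictScalars k
            (((M ⊔ L) ⊔ ⨆ j ∈ s, Submodule.span B {e j}).comap
              (LinearMap.toSpanSingleton B N (e i)))) := by
          rw [Submodule.Quotient.subsingleton_iff, eq_top_iff]
          intro b _
          exact Submodule.mem_sup_left (Submodule.mem_sup_right (L.smul_mem b hei))
        exact hν.of_subsingleton hS (hβ.quot _ _)
      · exact hJ _ _ (lt_comap_toSpanSingleton_of_maximal hmax (he i) I hI hei _ le_sup_left)
  -- `M ⊕ L` is the kernel of an epimorphism between members of `S`, and `M` is a direct summand of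
  -- it.
  have hFh : Has S (restrict ν _ hF) :=
    Has.of_exact₁ hS (hν.1.restrict _ hF) hν hT _ _ (isColinear_subtype _ hF) (isColinear_mkQ _ hF)
      (Submodule.injective_subtype _) (Submodule.mkQ_surjective _)
      (LinearMap.exact_subtype_mkQ _)
  refine Has.restrict_of_disjoint hS hν.1 hM hL hF hFh ?_ (Submodule.restrictScalars_sup k M L)
  rw [Submodule.disjoint_def]
  exact fun x ↦ (Submodule.disjoint_def.1 hLM) x

end AlgGroup

/-! ### Hopf modules and noetherian induction -/

namespace AlgGroup

variable {k : Type u} [Field k] {A : Type u} [CommRing A] [HopfAlgebra k A]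
  {V W : Type u} [AddCommGroup V] [Module k V] [AddCommGroup W] [Module k W]
  {S : ObjectProperty (Comod k A)} {ρ : V →ₗ[k] V ⊗[k] A} {σ : W →ₗ[k] W ⊗[k] A}

theorem IsCoaction.injective (hρ : IsCoaction ρ) : Function.Injective ρ :=
  Function.LeftInverse.injective (g := counitMap k A V) fun v ↦ LinearMap.congr_fun hρ.counit v

theorem IsColinear.symm {e : V ≃ₗ[k] W} (he : IsColinear ρ σ e.toLinearMap) :
    IsColinear σ ρ e.symm.toLinearMap := by
  rw [IsColinear, ← LinearMap.cancel_right e.surjective]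
  ext v
  simp only [LinearMap.comp_apply, LinearEquiv.coe_coe, e.symm_apply_apply]
  rw [show σ (e v) = _ from he.apply v, ← LinearMap.comp_apply, ← LinearMap.rTensor_comp]
  simp

/-- A comodule lies in the class `S` if its image under the coaction does. -/
theorem Has.of_range (hS : IsFilteredThick S) (hρ : IsCoaction ρ)
    (hst : IsStable (comulMap k A V) (LinearMap.range ρ))
    (h : Has S (restrict (comulMap k A V) (LinearMap.range ρ) hst)) : Has S ρ := by
  let e := LinearEquiv.ofInjective ρ hρ.injective
  have he : IsColinear ρ (restrict (comulMap k A V) (LinearMap.range ρ) hst) e.toLinearMap :=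
    IsColinear.codRestrict (f := ρ) hρ.coassoc _ hst fun v ↦ ⟨v, rfl⟩
  exact h.of_linearEquiv hS hρ e.symm he.symm

variable {B : Type u} [CommRing B] [Algebra k B] (β : B →ₐ[k] B ⊗[k] A)

/-- The action of `B ⊗ A` on `V ⊗ A`, if `B` acts on `V`. -/
def tensorAction (θ : B →ₐ[k] Module.End k V) : B ⊗[k] A →ₐ[k] Module.End k (V ⊗[k] A) :=
  Module.endTensorEndAlgHom.comp (Algebra.TensorProduct.map θ (Algebra.lmul k A))

@[simp]
theorem tensorAction_tmul_tmul (θ : B →ₐ[k] Module.End k V) (b : B) (a : A) (v : V) (a' : A) :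
    tensorAction θ (b ⊗ₜ[k] a) (v ⊗ₜ[k] a') = θ b v ⊗ₜ[k] (a * a') := by
  simp [tensorAction, Module.endTensorEndAlgHom_apply]

/-- The map `b ↦ b v`. -/
def evalAt (θ : B →ₐ[k] Module.End k V) (v : V) : B →ₗ[k] V :=
  LinearMap.applyₗ v ∘ₗ θ.toLinearMap

@[simp]
theorem evalAt_apply (θ : B →ₐ[k] Module.End k V) (v : V) (b : B) : evalAt θ v b = θ b v := rfl

theorem tensorAction_tmul_one (θ : B →ₐ[k] Module.End k V) (x : B ⊗[k] A) (v : V) :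
    tensorAction θ x (v ⊗ₜ 1) = (evalAt θ v).rTensor A x := by
  induction x with
  | zero => simp
  | tmul b a => simp
  | add x y hx hy => rw [map_add, map_add, LinearMap.add_apply, hx, hy]

/-- Commutativity of `B` moves `b` next to `v`. So `(b ⊗ 1) β(b')` evaluates at `v` to the action of
`b'` on the generator `b v ⊗ 1` of `V ⊗ A`. -/
theorem evalAt_rTensor_mul (θ : B →ₐ[k] Module.End k V) (b : B) (x : B ⊗[k] A) (v : V) :
    (evalAt θ v).rTensor A ((b ⊗ₜ 1) * x) = (evalAt θ (θ b v)).rTensor A x := by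
  induction x with
  | zero => simp
  | tmul b' a =>
    simp only [Algebra.TensorProduct.tmul_mul_tmul, one_mul, LinearMap.rTensor_tmul, evalAt_apply]
    rw [mul_comm b, map_mul, Module.End.mul_apply]
  | add x y hx hy => rw [mul_add, map_add, map_add, hx, hy]

/-- The action factors through `(B ⧸ I) ⊗ A`. For `x = β b` with `b` in a stable ideal, this shows
that the ideal kills `V ⊗ A` as soon as it kills `V`. -/
theorem tensorAction_eq_zero (θ : B →ₐ[k] Module.End k V) (I : Submodule k B)
    (hI : ∀ b ∈ I, θ b = 0) (x : B ⊗[k] A) (hx : I.mkQ.rTensor A x = 0) :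
    tensorAction θ x = 0 := by
  let θ' : B ⧸ I →ₗ[k] Module.End k V := I.liftQ θ.toLinearMap hI
  have h : (Algebra.TensorProduct.map θ (Algebra.lmul k A)).toLinearMap =
      TensorProduct.map θ' (Algebra.lmul k A).toLinearMap ∘ₗ I.mkQ.rTensor A :=
    TensorProduct.ext' fun b a ↦ rfl
  have hx' := LinearMap.congr_fun h x
  rw [LinearMap.comp_apply, hx, map_zero, AlgHom.toLinearMap_apply] at hx'
  rw [tensorAction, AlgHom.comp_apply, hx', map_zero]

/-- Let `V` be a Hopf module over a comodule algebra `B`, with `B ⊗ B → B ⊗ A` surjective, that is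
killed by a subcomodule ideal `I`. If all `B ⧸ J` with `I < J` lie in the class `S`, then so does
`V`. -/
theorem Has.of_hopfModule (hS : IsFilteredThick S) (hA : S (regular k A))
    (hβ : IsCoaction β.toLinearMap)
    (hcan : Submodule.span k (Set.range fun x : B × B ↦ (x.1 ⊗ₜ[k] (1 : A)) * β x.2) = ⊤)
    (θ : B →ₐ[k] Module.End k V) (hρ : IsCoaction ρ)
    (hθ : ∀ b v, ρ (θ b v) = tensorAction θ (β b) (ρ v))
    (I : Ideal B) (hIst : IsStable β.toLinearMap (I.restrictScalars k)) (hI : ∀ b ∈ I, θ b = 0)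
    (hJ : ∀ (J : Ideal B) (h : IsStable β.toLinearMap (J.restrictScalars k)), I < J →
      Has S (quot β.toLinearMap _ h)) : Has S ρ := by
  -- With `B` acting on the cofree comodule through `β`, the hypothesis `hθ` says that `ρ` is
  -- `B`-linear.
  let φ : B →ₐ[k] Module.End k (V ⊗[k] A) := (tensorAction θ).comp β
  let : Module B (V ⊗[k] A) := Module.compHom _ φ.toRingHom
  have hsmul (b : B) (x : V ⊗[k] A) : b • x = tensorAction θ (β b) x := rfl
  have : IsScalarTower k B (V ⊗[k] A) := ⟨fun c b x ↦ by
    rw [hsmul, hsmul, map_smul, map_smul, LinearMap.smul_apply]⟩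
  have horb (v : V) : orbitMap k B (v ⊗ₜ[k] (1 : A)) = (evalAt θ v).rTensor A ∘ₗ β.toLinearMap := by
    ext b
    exact tensorAction_tmul_one θ (β b) v
  let M : Submodule B (V ⊗[k] A) :=
    { LinearMap.range ρ with
      smul_mem' := by
        rintro b _ ⟨v, rfl⟩
        exact ⟨θ b v, hθ b v⟩ }
  have hM : M.restrictScalars k = LinearMap.range ρ := rfl
  have hst : IsStable (comulMap k A V) (LinearMap.range ρ) := isStable_range hρ.coassoc
  refine Has.of_range hS hρ hst (Has.restrict_of_span_eq_top hS hβ (has_comulMap hS hA V)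
    (fun v : V ↦ v ⊗ₜ[k] (1 : A)) (fun v ↦ ?_) ?_ I (fun b hb x ↦ ?_) hJ M hst)
  · rw [IsColinear, horb, ← LinearMap.comp_assoc, comulMap_naturality, LinearMap.comp_assoc,
      hβ.coassoc, ← LinearMap.comp_assoc, ← LinearMap.rTensor_comp]
  · have key (v : V) (x : B ⊗[k] A) : (evalAt θ v).rTensor A x ∈
        Submodule.span B (Set.range fun v : V ↦ v ⊗ₜ[k] (1 : A)) := by
      have hx : x ∈ Submodule.span k (Set.range fun x : B × B ↦ (x.1 ⊗ₜ[k] (1 : A)) * β x.2) :=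
        hcan ▸ Submodule.mem_top
      refine Submodule.span_le (p := ((Submodule.span B (Set.range fun v : V ↦
        v ⊗ₜ[k] (1 : A))).restrictScalars k).comap ((evalAt θ v).rTensor A)).2 ?_ hx
      rintro _ ⟨⟨b, b'⟩, rfl⟩
      change (evalAt θ v).rTensor A ((b ⊗ₜ 1) * β b') ∈ Submodule.span B _
      rw [evalAt_rTensor_mul, ← tensorAction_tmul_one, ← hsmul]
      exact Submodule.smul_mem _ _ (Submodule.subset_span ⟨_, rfl⟩)
    rw [eq_top_iff]
    intro x _
    induction x with
    | zero => exact zero_mem _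
    | tmul v a => simpa using key v (1 ⊗ₜ a)
    | add x y hx hy => exact add_mem (hx trivial) (hy trivial)
  · rw [hsmul, tensorAction_eq_zero θ (I.restrictScalars k) hI (β b) (hIst b hb),
      LinearMap.zero_apply]

/-- The action of an algebra on its quotient by an ideal. -/
def quotAction (k : Type u) [Field k] {B : Type u} [CommRing B] [Algebra k B] (I : Ideal B) :
    B →ₐ[k] Module.End k (B ⧸ I.restrictScalars k) where
  toFun b := (I.restrictScalars k).mapQ _ (LinearMap.mulLeft k b) fun _ hx ↦ I.mul_mem_left b hx
  map_one' := by
    ext z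
    exact congrArg (Submodule.Quotient.mk (p := I.restrictScalars k)) (one_mul z)
  map_mul' x y := by
    ext z
    exact congrArg (Submodule.Quotient.mk (p := I.restrictScalars k)) (mul_assoc x y z)
  map_zero' := by
    ext z
    exact congrArg (Submodule.Quotient.mk (p := I.restrictScalars k)) (zero_mul z)
  map_add' x y := by
    ext z
    exact congrArg (Submodule.Quotient.mk (p := I.restrictScalars k)) (add_mul x y z)
  commutes' r := by
    ext z
    exact congrArg (Submodule.Quotient.mk (p := I.restrictScalars k)) (Algebra.smul_def r z).symm

/-- The quotient of a noetherian comodule algebra `B` with `B ⊗ B → B ⊗ A` surjective by a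
subcomodule ideal lies in every filtered thick class that contains `A`. -/
theorem has_quot_ideal [IsNoetherianRing B] (hS : IsFilteredThick S) (hA : S (regular k A))
    (hβ : IsCoaction β.toLinearMap)
    (hcan : Submodule.span k (Set.range fun x : B × B ↦ (x.1 ⊗ₜ[k] (1 : A)) * β x.2) = ⊤)
    (I : Ideal B) (hI : IsStable β.toLinearMap (I.restrictScalars k)) :
    Has S (quot β.toLinearMap _ hI) := by
  induction I using IsNoetherian.induction with
  | _ I ih =>
    -- `B ⧸ I` is itself a Hopf module killed by `I`, so the induction hypothesis on larger ideals
    -- suffices.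
    refine Has.of_hopfModule β hS hA hβ hcan (quotAction k I) (hβ.quot _ hI) (fun b v ↦ ?_) I hI
      (fun b hb ↦ ?_) fun J hJ hIJ ↦ ih J hIJ hJ
    · obtain ⟨b', rfl⟩ := (I.restrictScalars k).mkQ_surjective v
      have key (x y : B ⊗[k] A) : tensorAction (quotAction k I) x
          ((I.restrictScalars k).mkQ.rTensor A y) = (I.restrictScalars k).mkQ.rTensor A (x * y) := by
        induction x with
        | zero => simp
        | add x x' hx hx' => rw [map_add, LinearMap.add_apply, hx, hx', add_mul, map_add]
        | tmul b a =>
          induction y with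
          | zero => simp
          | add y y' hy hy' => rw [map_add, map_add, hy, hy', mul_add, map_add]
          | tmul b' a' =>
            rw [LinearMap.rTensor_tmul, Algebra.TensorProduct.tmul_mul_tmul, LinearMap.rTensor_tmul]
            exact tensorAction_tmul_tmul (quotAction k I) b a ((I.restrictScalars k).mkQ b') a'
      have h1 (b : B) := (isColinear_mkQ _ hI).apply b
      rw [h1]
      change quot _ _ hI (Submodule.mkQ _ (b * b')) = _
      rw [h1, AlgHom.toLinearMap_apply, AlgHom.toLinearMap_apply, map_mul, key]
    · ext x
      exact (Submodule.Quotient.mk_eq_zero _).2 (Ideal.mul_mem_right x I hb)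

end AlgGroup

/-! ### Tensor products of comodules and the retraction -/

namespace AlgGroup

variable {k : Type u} [Field k] {A : Type u} [CommRing A] [HopfAlgebra k A]
  {V W V' W' : Type u} [AddCommGroup V] [Module k V] [AddCommGroup W] [Module k W]
  [AddCommGroup V'] [Module k V'] [AddCommGroup W'] [Module k W']
  {S : ObjectProperty (Comod k A)} {ρ : V →ₗ[k] V ⊗[k] A} {σ : W →ₗ[k] W ⊗[k] A}

variable (k A V W) in
/-- The map `(V ⊗ A) ⊗ (W ⊗ A) → (V ⊗ W) ⊗ A` given by the multiplication of `A`. -/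
def combine : (V ⊗[k] A) ⊗[k] (W ⊗[k] A) →ₗ[k] (V ⊗[k] W) ⊗[k] A :=
  (LinearMap.mul' k A).lTensor (V ⊗[k] W) ∘ₗ
    (TensorProduct.tensorTensorTensorComm k V A W A).toLinearMap

@[simp]
theorem combine_tmul (v : V) (a : A) (w : W) (b : A) :
    combine k A V W ((v ⊗ₜ a) ⊗ₜ (w ⊗ₜ b)) = (v ⊗ₜ w) ⊗ₜ (a * b) := by
  simp [combine]

/-- Two linear maps on `(V ⊗ A) ⊗ (W ⊗ A)` agree if they agree on pure tensors. -/
theorem ext_pure {X : Type u} [AddCommGroup X] [Module k X]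
    {f g : (V ⊗[k] A) ⊗[k] (W ⊗[k] A) →ₗ[k] X}
    (h : ∀ v a w b, f ((v ⊗ₜ a) ⊗ₜ (w ⊗ₜ b)) = g ((v ⊗ₜ a) ⊗ₜ (w ⊗ₜ b))) : f = g := by
  ext v a w b
  exact h v a w b

theorem combine_naturality (f : V →ₗ[k] V') (g : W →ₗ[k] W') :
    combine k A V' W' ∘ₗ TensorProduct.map (f.rTensor A) (g.rTensor A) =
      (TensorProduct.map f g).rTensor A ∘ₗ combine k A V W :=
  ext_pure fun v a w b ↦ by simp

theorem counitMap_comp_combine : counitMap k A (V ⊗[k] W) ∘ₗ combine k A V W =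
    TensorProduct.map (counitMap k A V) (counitMap k A W) :=
  ext_pure fun v a w b ↦ by simp [counitMap, TensorProduct.smul_tmul', smul_smul, mul_comm]

theorem comulMap_comp_combine : comulMap k A (V ⊗[k] W) ∘ₗ combine k A V W =
    (combine k A V W).rTensor A ∘ₗ combine k A (V ⊗[k] A) (W ⊗[k] A) ∘ₗ
      TensorProduct.map (comulMap k A V) (comulMap k A W) := by
  refine ext_pure (X := ((V ⊗[k] W) ⊗[k] A) ⊗[k] A) fun v a w b ↦ ?_
  have key (p q : A ⊗[k] A) : (TensorProduct.mk k (V ⊗[k] W) A (v ⊗ₜ w)).rTensor A (p * q) =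
      (combine k A V W).rTensor A (combine k A (V ⊗[k] A) (W ⊗[k] A)
        ((TensorProduct.mk k V A v).rTensor A p ⊗ₜ (TensorProduct.mk k W A w).rTensor A q)) := by
    induction p with
    | zero => simp
    | add p p' hp hp' => rw [add_mul, map_add, hp, hp', map_add, add_tmul, map_add, map_add]
    | tmul a a' =>
      induction q with
      | zero => simp
      | add q q' hq hq' => rw [mul_add, map_add, hq, hq', map_add, tmul_add, map_add, map_add]
      | tmul b b' => simp
  simp only [LinearMap.comp_apply, combine_tmul, TensorProduct.map_tmul, comulMap_tmul,
    Bialgebra.comul_mul, key]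

/-- The diagonal coaction on the tensor product of two comodules. -/
def tensorCoaction (ρ : V →ₗ[k] V ⊗[k] A) (σ : W →ₗ[k] W ⊗[k] A) :
    V ⊗[k] W →ₗ[k] (V ⊗[k] W) ⊗[k] A :=
  combine k A V W ∘ₗ TensorProduct.map ρ σ

theorem IsCoaction.tensor (hρ : IsCoaction ρ) (hσ : IsCoaction σ) :
    IsCoaction (tensorCoaction ρ σ) where
  counit := by
    rw [tensorCoaction, ← LinearMap.comp_assoc, counitMap_comp_combine, ← TensorProduct.map_comp,
      hρ.counit, hσ.counit, TensorProduct.map_id]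
  coassoc := by
    rw [tensorCoaction, ← LinearMap.comp_assoc, comulMap_comp_combine, LinearMap.comp_assoc,
      LinearMap.comp_assoc, ← TensorProduct.map_comp, hρ.coassoc, hσ.coassoc,
      TensorProduct.map_comp, ← LinearMap.comp_assoc (TensorProduct.map ρ σ), combine_naturality,
      LinearMap.rTensor_comp]
    rfl

variable {B : Type u} [CommRing B] [Algebra k B] (β : B →ₐ[k] B ⊗[k] A)

/-- This is the Hopf module condition for `B ⊗ V`; it comes from the multiplicativity of `β`. -/
theorem tensorCoaction_smul (b : B) (x : B ⊗[k] V) :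
    tensorCoaction β.toLinearMap ρ (Algebra.lsmul k k (B ⊗[k] V) b x) =
      tensorAction (Algebra.lsmul k k (B ⊗[k] V)) (β b) (tensorCoaction β.toLinearMap ρ x) := by
  have key (p q : B ⊗[k] A) (r : V ⊗[k] A) : combine k A B V ((p * q) ⊗ₜ r) =
      tensorAction (Algebra.lsmul k k (B ⊗[k] V)) p (combine k A B V (q ⊗ₜ r)) := by
    induction p with
    | zero => simp
    | add p p' hp hp' => rw [add_mul, add_tmul, map_add, hp, hp', map_add, LinearMap.add_apply]
    | tmul b a =>
      induction q with
      | zero => simp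
      | add q q' hq hq' => rw [mul_add, add_tmul, map_add, hq, hq', add_tmul, map_add, map_add]
      | tmul b' a' =>
        induction r with
        | zero => simp
        | add r r' hr hr' => rw [tmul_add, map_add, hr, hr', tmul_add, map_add, map_add]
        | tmul v c => simp [TensorProduct.smul_tmul', mul_assoc]
  induction x with
  | zero => simp
  | add x y hx hy => simp only [map_add, hx, hy]
  | tmul b' v =>
    simp only [tensorCoaction, Algebra.lsmul_coe, TensorProduct.smul_tmul', smul_eq_mul,
      LinearMap.comp_apply, TensorProduct.map_tmul, AlgHom.toLinearMap_apply, map_mul, key]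

theorem isColinear_mk_one :
    IsColinear ρ (tensorCoaction β.toLinearMap ρ) (TensorProduct.mk k B V 1) := by
  ext v
  have key (x : V ⊗[k] A) : combine k A B V (1 ⊗ₜ x) = (TensorProduct.mk k B V 1).rTensor A x := by
    induction x with
    | zero => simp
    | add x y hx hy => rw [tmul_add, map_add, map_add, hx, hy]
    | tmul v a => simp [Algebra.TensorProduct.one_def]
  simp [tensorCoaction, key]

/-- `hJ` says that `J` is colinear to the trivial comodule `k`; the map is `J ⊗ V` followed by `k ⊗
V ≅ V`. -/
theorem isColinear_lid_rTensor (J : B →ₗ[k] k)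
    (hJ : ∀ b, TensorProduct.lid k A (J.rTensor A (β b)) = algebraMap k A (J b)) :
    IsColinear (tensorCoaction β.toLinearMap ρ) ρ
      ((TensorProduct.lid k V).toLinearMap ∘ₗ J.rTensor V) := by
  have key (p : B ⊗[k] A) (q : V ⊗[k] A) :
      ((TensorProduct.lid k V).toLinearMap ∘ₗ J.rTensor V).rTensor A (combine k A B V (p ⊗ₜ q)) =
        (LinearMap.mulLeft k (TensorProduct.lid k A (J.rTensor A p))).lTensor V q := by
    induction q with
    | zero => simp
    | add q q' hq hq' => rw [tmul_add, map_add, map_add, hq, hq', map_add]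
    | tmul v a =>
      induction p with
      | zero => simp
      | add p p' hp hp' =>
        rw [add_tmul, map_add, map_add, hp, hp', map_add, map_add]
        simp [add_mul, tmul_add]
      | tmul b a' => simp [TensorProduct.smul_tmul]
  refine TensorProduct.ext' fun b v ↦ ?_
  simp only [tensorCoaction, LinearMap.comp_apply, TensorProduct.map_tmul]
  have := key (β b) (ρ v)
  simp only [AlgHom.toLinearMap_apply]
  rw [this, hJ]
  have h : LinearMap.mulLeft k (algebraMap k A (J b)) = J b • LinearMap.id := by
    ext a
    simp [Algebra.smul_def]
  rw [h, LinearMap.lTensor_smul]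
  simp

/-- If a noetherian comodule algebra `B` with `B ⊗ B → B ⊗ A` surjective has a colinear retraction
to `k`, then every filtered thick class of comodules that contains `A` contains everything. -/
theorem IsFilteredThick.eq_top [IsNoetherianRing B] (hS : IsFilteredThick S)
    (hA : S (regular k A)) (hβ : IsCoaction β.toLinearMap)
    (hcan : Submodule.span k (Set.range fun x : B × B ↦ (x.1 ⊗ₜ[k] (1 : A)) * β x.2) = ⊤)
    (J : B →ₗ[k] k) (hJ1 : J 1 = 1)
    (hJ : ∀ b, TensorProduct.lid k A (J.rTensor A (β b)) = algebraMap k A (J b))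
    (X : Comod k A) : S X := by
  have hX := Comod.isCoaction X
  have h1 : Has S (tensorCoaction β.toLinearMap (ModuleCat.Hom.hom X.a : X.A →ₗ[k] X.A ⊗[k] A)) :=
    Has.of_hopfModule β hS hA hβ hcan (Algebra.lsmul k k _) (hβ.tensor hX)
      (tensorCoaction_smul β) ⊥ (fun b hb ↦ by
        obtain rfl : b = 0 := hb
        rw [map_zero, map_zero]) (fun b hb ↦ by
        obtain rfl : b = 0 := hb
        simp) fun I hI _ ↦ has_quot_ideal β hS hA hβ hcan I hI
  exact (h1.of_retract hS hX _ _ (isColinear_mk_one β) (isColinear_lid_rTensor β J hJ)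
    (by ext; simp [hJ1])).2

end AlgGroup

/-! ### The apolar pairing -/

namespace MvPolynomial

variable {σ R : Type*} [CommRing R]

/-- The apolar pairing of polynomials, for which the monomials are orthogonal and `x ^ α` has
square `α!`. -/
def apolar : MvPolynomial σ R →ₗ[R] MvPolynomial σ R →ₗ[R] R :=
  (basisMonomials σ R).constr R fun α ↦ (α.prod fun _ n ↦ (n.factorial : R)) • lcoeff R α

theorem apolar_monomial (α : σ →₀ ℕ) (c : R) (g : MvPolynomial σ R) :
    apolar (monomial α c) g = c * (α.prod fun _ n ↦ (n.factorial : R)) * coeff α g := by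
  have h : monomial α c = c • basisMonomials σ R α := by simp [smul_monomial]
  rw [h, map_smul, apolar, Module.Basis.constr_basis]
  simp [mul_assoc]

theorem apolar_eq_sum (f g : MvPolynomial σ R) : apolar f g =
    ∑ α ∈ f.support, (α.prod fun _ n ↦ (n.factorial : R)) * (coeff α f * coeff α g) := by
  conv_lhs => rw [f.as_sum]
  rw [map_sum, LinearMap.sum_apply]
  exact Finset.sum_congr rfl fun α _ ↦ by rw [apolar_monomial]; ring

theorem apolar_C (c : R) (g : MvPolynomial σ R) : apolar (C c) g = c * constantCoeff g := by
  rw [C_apply, apolar_monomial]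
  simp [constantCoeff_eq]

theorem apolar_map {R' : Type*} [CommRing R'] (φ : R →+* R') (f g : MvPolynomial σ R) :
    apolar (map φ f) (map φ g) = φ (apolar f g) := by
  induction f using MvPolynomial.monomial_add_induction_on with
  | C c => simp [apolar_C, constantCoeff_map]
  | monomial_add α c f _ _ hf =>
    rw [map_add, map_add, map_add, LinearMap.add_apply, LinearMap.add_apply, hf, map_add,
      map_monomial, apolar_monomial, apolar_monomial]
    simp [Finsupp.prod, coeff_map]

/-- On monomials this is `(α + e_s)! = (α_s + 1) α!`. -/
theorem apolar_mul_X (f g : MvPolynomial σ R) (s : σ) :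
    apolar (f * X s) g = apolar f (pderiv s g) := by
  classical
  induction f using MvPolynomial.induction_on' with
  | add f f' hf hf' => rw [add_mul, map_add, map_add, LinearMap.add_apply, hf, hf',
      LinearMap.add_apply]
  | monomial α c =>
    rw [X, monomial_mul, apolar_monomial, apolar_monomial, coeff_pderiv]
    have h : ((α + Finsupp.single s 1).prod fun _ n ↦ (n.factorial : R)) =
        (α.prod fun _ n ↦ (n.factorial : R)) * (α s + 1) := by
      -- Both products are taken over the support of `α` with `s` added, as `s` may be missing from
      -- it.
      have h0 (β : σ →₀ ℕ) (hβ : β.support ⊆ insert s α.support) :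
          (β.prod fun _ n ↦ (n.factorial : R)) =
            ((β s).factorial : R) * ∏ t ∈ α.support.erase s, ((β t).factorial : R) := by
        rw [Finsupp.prod_of_support_subset _ hβ _ (by simp), ← Finset.insert_erase
          (Finset.mem_insert_self s α.support), Finset.prod_insert (Finset.notMem_erase _ _),
          Finset.erase_insert_eq_erase]
      rw [h0 α (Finset.subset_insert _ _), h0 (α + Finsupp.single s 1)]
      · have : ∏ t ∈ α.support.erase s, (((α + Finsupp.single s 1 : σ →₀ ℕ) t).factorial : R) =
            ∏ t ∈ α.support.erase s, ((α t).factorial : R) :=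
          Finset.prod_congr rfl fun t ht ↦ by
            simp [Finsupp.single_eq_of_ne (Finset.ne_of_mem_erase ht)]
        rw [this]
        simp [Nat.factorial_succ]
        ring
      · refine Finsupp.support_add.trans ?_
        rw [Finset.union_subset_iff]
        exact ⟨Finset.subset_insert _ _, Finsupp.support_single_subset.trans (by simp)⟩
    rw [h]
    ring

/-- A sum of squares with positive weights; the integers provide the order that `k` lacks. -/
theorem apolar_self_pos {f : MvPolynomial σ ℤ} (hf : f ≠ 0) : 0 < apolar f f := by
  rw [apolar_eq_sum]
  refine Finset.sum_pos (fun α hα ↦ mul_pos ?_ (mul_self_pos.2 (mem_support_iff.1 hα)))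
    (support_nonempty.2 hf)
  exact Finset.prod_pos fun s _ ↦ by positivity

variable [Fintype σ]

/-- The linear substitution `x_s ↦ ∑ t, M s t x_t`. -/
def linSubst (M : Matrix σ σ R) : MvPolynomial σ R →ₐ[R] MvPolynomial σ R :=
  aeval fun s ↦ ∑ t, C (M s t) * X t

@[simp]
theorem linSubst_X (M : Matrix σ σ R) (s : σ) : linSubst M (X s) = ∑ t, C (M s t) * X t :=
  aeval_X _ _

theorem constantCoeff_linSubst (M : Matrix σ σ R) (f : MvPolynomial σ R) :
    constantCoeff (linSubst M f) = constantCoeff f := by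
  induction f using MvPolynomial.induction_on with
  | C c => rw [← algebraMap_eq, AlgHom.commutes]
  | add f g hf hg => simp only [map_add, hf, hg]
  | mul_X f s hf => simp

theorem pderiv_linSubst (M : Matrix σ σ R) (s : σ) (f : MvPolynomial σ R) :
    pderiv s (linSubst M f) = ∑ t, C (M t s) * linSubst M (pderiv t f) := by
  classical
  induction f using MvPolynomial.induction_on with
  | C c => rw [← algebraMap_eq, AlgHom.commutes]; simp [algebraMap_eq]
  | add f g hf hg => simp only [map_add, hf, hg, mul_add, Finset.sum_add_distrib]
  | mul_X f u hf =>
    have h : pderiv s (linSubst M (X u)) = C (M u s) := by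
      simp [pderiv_X, Pi.single_apply]
    have h' (t : σ) : linSubst M (pderiv t (f * X u)) =
        linSubst M (pderiv t f) * linSubst M (X u) + if u = t then linSubst M f else 0 := by
      rw [Derivation.leibniz, pderiv_X, Pi.single_apply]
      split_ifs <;> simp [mul_comm, add_comm]
    rw [map_mul, Derivation.leibniz, hf, h]
    simp only [h', mul_add, Finset.sum_add_distrib, mul_ite, mul_zero, Finset.sum_ite_eq,
      Finset.mem_univ, if_true, smul_eq_mul, ← mul_assoc, ← Finset.sum_mul]
    ring

/-- Multiplication by a linear form is adjoint to a directional derivative, and the chain rule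
`pderiv_linSubst` produces the transposed matrix. -/
theorem apolar_linSubst (M : Matrix σ σ R) (f g : MvPolynomial σ R) :
    apolar (linSubst M f) g = apolar f (linSubst M.transpose g) := by
  induction f using MvPolynomial.induction_on generalizing g with
  | C c =>
    rw [← algebraMap_eq, AlgHom.commutes, algebraMap_eq, apolar_C, apolar_C,
      constantCoeff_linSubst]
  | add f f' hf hf' => simp only [map_add, LinearMap.add_apply, hf, hf']
  | mul_X f s hf =>
    rw [map_mul, linSubst_X, apolar_mul_X, pderiv_linSubst, Finset.mul_sum, map_sum, map_sum,
      LinearMap.sum_apply]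
    refine Finset.sum_congr rfl fun t _ ↦ ?_
    rw [mul_left_comm, C_mul', C_mul', map_smul, map_smul, LinearMap.smul_apply, apolar_mul_X, hf,
      Matrix.transpose_apply]

end MvPolynomial

/-! ### Linear substitutions as coactions -/

namespace MvPolynomial

section LinCoaction

variable {k R σ : Type*} [CommRing k] [CommRing R] [Algebra k R]

variable (k R σ) in
/-- The homomorphism `k[x] ⊗ R → R[x]`. -/
def scalarExtension : MvPolynomial σ k ⊗[k] R →ₐ[k] MvPolynomial σ R :=
  Algebra.TensorProduct.productMap (mapAlgHom (Algebra.ofId k R))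
    (IsScalarTower.toAlgHom k R (MvPolynomial σ R))

theorem scalarExtension_tmul (f : MvPolynomial σ k) (r : R) :
    scalarExtension k R σ (f ⊗ₜ r) = r • map (algebraMap k R) f := by
  simp [scalarExtension, Algebra.smul_def, mul_comm]

theorem lid_apolar_rTensor (f : MvPolynomial σ k) (x : MvPolynomial σ k ⊗[k] R) :
    TensorProduct.lid k R ((apolar f).rTensor R x) =
      apolar (map (algebraMap k R) f) (scalarExtension k R σ x) := by
  induction x with
  | zero => simp
  | add x y hx hy => simp only [map_add, hx, hy]
  | tmul g r =>
    rw [scalarExtension_tmul, map_smul, apolar_map]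
    simp [Algebra.smul_def, mul_comm]

variable [Fintype σ]

variable (k) in
/-- The algebra homomorphism `x_s ↦ ∑ t, x_t ⊗ N s t`. -/
def linCoaction (N : Matrix σ σ R) : MvPolynomial σ k →ₐ[k] MvPolynomial σ k ⊗[k] R :=
  aeval fun s ↦ ∑ t, X t ⊗ₜ N s t

@[simp]
theorem linCoaction_X (N : Matrix σ σ R) (s : σ) :
    linCoaction k N (X s) = ∑ t, X t ⊗ₜ N s t :=
  aeval_X _ _

theorem scalarExtension_linCoaction (N : Matrix σ σ R) (f : MvPolynomial σ k) :
    scalarExtension k R σ (linCoaction k N f) = linSubst N (map (algebraMap k R) f) := by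
  have h : (scalarExtension k R σ).comp (linCoaction k N) =
      ((linSubst N).restrictScalars k).comp (mapAlgHom (Algebra.ofId k R)) :=
    algHom_ext fun s ↦ by simp [scalarExtension_tmul, C_mul']
  exact DFunLike.congr_fun h f

/-- Over `R` the coaction is a substitution; adjointness moves it onto `f`, an eigenvector of the
transposed substitution. -/
theorem lid_apolar_rTensor_linCoaction (N : Matrix σ σ R) (f g : MvPolynomial σ k) (d : R)
    (h : linSubst N.transpose (map (algebraMap k R) f) = d • map (algebraMap k R) f) :
    TensorProduct.lid k R ((apolar f).rTensor R (linCoaction k N g)) = apolar f g • d := by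
  have h' := apolar_linSubst N.transpose (map (algebraMap k R) f) (map (algebraMap k R) g)
  rw [Matrix.transpose_transpose, h, map_smul, LinearMap.smul_apply, apolar_map] at h'
  rw [lid_apolar_rTensor, scalarExtension_linCoaction, ← h', smul_eq_mul, Algebra.smul_def,
    mul_comm]

end LinCoaction

/-! ### Powers of the determinant and the Reynolds operator -/

section Det

open scoped Kronecker

variable {ι : Type*} [Fintype ι] [DecidableEq ι]

section

variable {R : Type*} [CommRing R]

variable (ι R) in
/-- The determinant of the generic matrix. -/
def genericDet : MvPolynomial (ι × ι) R := (Matrix.mvPolynomialX ι ι R).det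

theorem map_genericDet {R' : Type*} [CommRing R'] (φ : R →+* R') :
    map φ (genericDet ι R) = genericDet ι R' := by
  rw [genericDet, RingHom.map_det, genericDet]
  congr 1
  ext i j : 1
  simp

/-- Substitution through `1 ⊗ₖ b` turns the generic matrix `X` into `X bᵀ`; substitution through `b
⊗ₖ 1`, below, turns it into `b X`. -/
theorem linSubst_one_kronecker_genericDet (b : Matrix ι ι R) :
    linSubst (1 ⊗ₖ b) (genericDet ι R) = b.det • genericDet ι R := by
  have h : (linSubst (1 ⊗ₖ b)).mapMatrix (Matrix.mvPolynomialX ι ι R) =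
      Matrix.mvPolynomialX ι ι R * (C.mapMatrix b).transpose := by
    ext i j : 1
    simp [Matrix.mul_apply, Fintype.sum_prod_type_right, Matrix.one_apply, mul_comm,
      apply_ite (C (R := R) (σ := ι × ι))]
  rw [genericDet, AlgHom.map_det, h, Matrix.det_mul, Matrix.det_transpose, ← RingHom.map_det,
    smul_eq_C_mul, mul_comm]

theorem linSubst_kronecker_one_genericDet (b : Matrix ι ι R) :
    linSubst (b ⊗ₖ 1) (genericDet ι R) = b.det • genericDet ι R := by
  have h : (linSubst (b ⊗ₖ 1)).mapMatrix (Matrix.mvPolynomialX ι ι R) =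
      C.mapMatrix b * Matrix.mvPolynomialX ι ι R := by
    ext i j : 1
    simp [Matrix.mul_apply, Fintype.sum_prod_type, Matrix.one_apply,
      apply_ite (C (R := R) (σ := ι × ι))]
  rw [genericDet, AlgHom.map_det, h, Matrix.det_mul, ← RingHom.map_det, smul_eq_C_mul]

variable (ι R) in
theorem isHomogeneous_genericDet : (genericDet ι R).IsHomogeneous (Fintype.card ι) := by
  rw [genericDet, Matrix.det_apply]
  refine IsHomogeneous.sum _ _ _ fun s _ ↦ ?_
  have h : (∏ i, Matrix.mvPolynomialX ι ι R (s i) i).IsHomogeneous (∑ _i : ι, 1) :=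
    IsHomogeneous.prod _ _ _ fun i _ ↦ isHomogeneous_X _ _
  rw [Finset.sum_const, Finset.card_univ, smul_eq_mul, mul_one] at h
  rw [Units.smul_def]
  rw [← Int.cast_smul_eq_zsmul R]
  exact (homogeneousSubmodule _ _ _).smul_mem _ h

end

variable {k : Type*} [Field k]

variable (ι k) in
-- The value is the image of a positive integer, hence nonzero in characteristic zero.
theorem apolar_genericDet_pow_ne_zero [CharZero k] (p : ℕ) :
    apolar (genericDet ι k ^ p) (genericDet ι k ^ p) ≠ 0 := by
  rw [← map_genericDet (Int.castRingHom k), ← map_pow, apolar_map]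
  exact Int.cast_ne_zero.2 (apolar_self_pos
    (pow_ne_zero p (Matrix.det_mvPolynomialX_ne_zero ι ℤ))).ne'

variable (ι k) in
/-- The linear form on polynomials in the entries of a square matrix which sends the `p`-th power of
the determinant to `1` and its apolar complement to `0`. -/
def detPowCoeff (p : ℕ) : MvPolynomial (ι × ι) k →ₗ[k] k :=
  (apolar (genericDet ι k ^ p) (genericDet ι k ^ p))⁻¹ • apolar (genericDet ι k ^ p)

theorem detPowCoeff_genericDet_pow [CharZero k] (p : ℕ) :
    detPowCoeff ι k p (genericDet ι k ^ p) = 1 :=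
  inv_mul_cancel₀ (apolar_genericDet_pow_ne_zero ι k p)

theorem detPowCoeff_zero (f : MvPolynomial (ι × ι) k) :
    detPowCoeff ι k 0 f = constantCoeff f := by
  rw [detPowCoeff, pow_zero, ← C_1, LinearMap.smul_apply, apolar_C, apolar_C]
  simp

/-- `det ^ p` is homogeneous of degree `p * card ι ≥ p`, so it shares no monomial with `f`. This
makes the sum over `p` finite. -/
theorem detPowCoeff_eq_zero [Nonempty ι] {f : MvPolynomial (ι × ι) k} {p : ℕ}
    (hp : f.totalDegree < p) : detPowCoeff ι k p f = 0 := by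
  have h : apolar (genericDet ι k ^ p) f = 0 := by
    rw [apolar_eq_sum]
    refine Finset.sum_eq_zero fun α hα ↦ ?_
    have h1 := ((isHomogeneous_genericDet ι k).pow p).coeff_eq_zero.mt (mem_support_iff.1 hα)
    rw [coeff_eq_zero_of_totalDegree_lt (f := f) (d := α), mul_zero, mul_zero]
    change _ < α.degree
    rw [not_not.1 h1]
    have := Fintype.card_pos (α := ι)
    nlinarith
  rw [detPowCoeff, LinearMap.smul_apply, h, smul_zero]

theorem exists_detPowCoeff_eq_zero [Nonempty ι] (f : MvPolynomial (ι × ι) k) :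
    ∃ N, ∀ p ≥ N, detPowCoeff ι k p f = 0 :=
  ⟨f.totalDegree + 1, fun _ hp ↦ detPowCoeff_eq_zero hp⟩

variable {R : Type*} [CommRing R] [Algebra k R]

theorem lid_detPowCoeff_rTensor (p : ℕ) (N : Matrix (ι × ι) (ι × ι) R) (d : R)
    (h : linSubst N.transpose (genericDet ι R) = d • genericDet ι R) (f : MvPolynomial (ι × ι) k) :
    TensorProduct.lid k R ((detPowCoeff ι k p).rTensor R (linCoaction k N f)) =
      detPowCoeff ι k p f • d ^ p := by
  rw [detPowCoeff, LinearMap.rTensor_smul, LinearMap.smul_apply, map_smul,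
    lid_apolar_rTensor_linCoaction N _ f (d ^ p), LinearMap.smul_apply, smul_assoc]
  rw [map_pow, map_genericDet, map_pow, h, smul_pow]

theorem lid_detPowCoeff_rTensor_right (p : ℕ) (a : Matrix ι ι R) (f : MvPolynomial (ι × ι) k) :
    TensorProduct.lid k R ((detPowCoeff ι k p).rTensor R
      (linCoaction k (1 ⊗ₖ a.transpose) f)) = detPowCoeff ι k p f • a.det ^ p := by
  refine lid_detPowCoeff_rTensor p _ _ ?_ f
  rw [← Matrix.kroneckerMap_transpose, Matrix.transpose_one, Matrix.transpose_transpose,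
    linSubst_one_kronecker_genericDet]

theorem lid_detPowCoeff_rTensor_left (p : ℕ) (a : Matrix ι ι R) (f : MvPolynomial (ι × ι) k) :
    TensorProduct.lid k R ((detPowCoeff ι k p).rTensor R
      (linCoaction k (a ⊗ₖ 1) f)) = detPowCoeff ι k p f • a.det ^ p := by
  refine lid_detPowCoeff_rTensor p _ _ ?_ f
  rw [← Matrix.kroneckerMap_transpose, Matrix.transpose_one,
    linSubst_kronecker_one_genericDet, Matrix.det_transpose]

theorem linCoaction_genericDet (a : Matrix ι ι R) :
    linCoaction k (1 ⊗ₖ a.transpose) (genericDet ι k) = genericDet ι k ⊗ₜ a.det := by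
  have h : (linCoaction k (1 ⊗ₖ a.transpose)).mapMatrix (Matrix.mvPolynomialX ι ι k) =
      (Algebra.TensorProduct.includeLeft (R := k) (S := k)).mapMatrix (Matrix.mvPolynomialX ι ι k) *
        (Algebra.TensorProduct.includeRight (R := k)).mapMatrix a := by
    ext i j
    simp [Matrix.mul_apply, Fintype.sum_prod_type_right, Matrix.one_apply, TensorProduct.tmul_ite]
  rw [genericDet, AlgHom.map_det, h, Matrix.det_mul, ← AlgHom.map_det, ← AlgHom.map_det]
  simp

/-- Both sides encode `f(XY)` for two generic matrices; swapping the factors turns right translation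
into left translation. -/
theorem comm_linCoaction (f : MvPolynomial (ι × ι) k) :
    TensorProduct.comm k _ _ (linCoaction k (1 ⊗ₖ (Matrix.mvPolynomialX ι ι k).transpose) f) =
      linCoaction k (Matrix.mvPolynomialX ι ι k ⊗ₖ 1) f := by
  have h : (Algebra.TensorProduct.comm k (MvPolynomial (ι × ι) k) (MvPolynomial (ι × ι) k)).toAlgHom.comp
      (linCoaction k (1 ⊗ₖ (Matrix.mvPolynomialX ι ι k).transpose)) =
      linCoaction k (Matrix.mvPolynomialX ι ι k ⊗ₖ 1) := by
    refine algHom_ext fun s ↦ ?_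
    simp [Fintype.sum_prod_type, Matrix.one_apply, TensorProduct.tmul_ite]
  exact DFunLike.congr_fun h f

/-- The form `L = detPowCoeff (p + 1) (det * ·)` has weight `p` for right translations, and
`detPowCoeff p` has weight `p` for left translations. Apply `L` in `X` and `detPowCoeff p` in `Y` to
`f(XY)`: one order gives `L f`, the other `detPowCoeff p f`, since both forms are `1` on `det ^ p`.
-/
theorem detPowCoeff_succ [CharZero k] (p : ℕ) (f : MvPolynomial (ι × ι) k) :
    detPowCoeff ι k (p + 1) (genericDet ι k * f) = detPowCoeff ι k p f := by
  let L : MvPolynomial (ι × ι) k →ₗ[k] k :=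
    detPowCoeff ι k (p + 1) ∘ₗ LinearMap.mulLeft k (genericDet ι k)
  have h1 : TensorProduct.lid k _ (L.rTensor _
      (linCoaction k (1 ⊗ₖ (Matrix.mvPolynomialX ι ι k).transpose) f)) =
      L f • genericDet ι k ^ p := by
    -- `detPowCoeff (p + 1)` has weight `p + 1`; the coaction of the factor `det` accounts for one
    -- `det`, which is cancelled.
    apply mul_left_cancel₀ (Matrix.det_mvPolynomialX_ne_zero ι k)
    have key (x : MvPolynomial (ι × ι) k ⊗[k] MvPolynomial (ι × ι) k) :
        TensorProduct.lid k _ ((detPowCoeff ι k (p + 1)).rTensor _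
          ((genericDet ι k ⊗ₜ (Matrix.mvPolynomialX ι ι k).det) * x)) =
        (Matrix.mvPolynomialX ι ι k).det * TensorProduct.lid k _ (L.rTensor _ x) := by
      induction x with
      | zero => simp
      | add x y hx hy => simp only [mul_add, map_add, hx, hy]
      | tmul g r => simp [L]
    rw [← key, ← linCoaction_genericDet, ← map_mul, lid_detPowCoeff_rTensor_right, pow_succ',
      mul_smul_comm]
    rfl
  have h2 (x : MvPolynomial (ι × ι) k ⊗[k] MvPolynomial (ι × ι) k) :
      detPowCoeff ι k p (TensorProduct.lid k _ (L.rTensor _ x)) =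
        L (TensorProduct.lid k _ ((detPowCoeff ι k p).rTensor _ (TensorProduct.comm k _ _ x))) := by
    induction x with
    | zero => simp
    | add x y hx hy => simp only [map_add, hx, hy]
    | tmul g r => simp [mul_comm]
  have h3 := congrArg (detPowCoeff ι k p) h1
  rw [h2, comm_linCoaction, lid_detPowCoeff_rTensor_left, map_smul, map_smul,
    detPowCoeff_genericDet_pow] at h3
  have h4 : L ((Matrix.mvPolynomialX ι ι k).det ^ p) = 1 := by
    change detPowCoeff ι k (p + 1) (genericDet ι k * genericDet ι k ^ p) = 1
    rw [← pow_succ', detPowCoeff_genericDet_pow]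
  rw [h4, smul_eq_mul, smul_eq_mul, mul_one, mul_one] at h3
  exact h3.symm

/-- The Reynolds operator of the special linear group, on polynomial functions on matrices. -/
def reynolds [Nonempty ι] : MvPolynomial (ι × ι) k →ₗ[k] k where
  toFun f := ∑ᶠ p, detPowCoeff ι k p f
  map_add' f g := by
    have h (f : MvPolynomial (ι × ι) k) : (Function.support fun p ↦ detPowCoeff ι k p f).Finite :=
      let ⟨N, hN⟩ := exists_detPowCoeff_eq_zero f
      (Set.finite_lt_nat N).subset fun p hp ↦ not_le.1 fun h ↦ hp (hN p h)
    rw [← finsum_add_distrib (h f) (h g)]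
    simp only [map_add]
  map_smul' c f := by
    simp only [map_smul, RingHom.id_apply, smul_finsum]

theorem reynolds_eq_sum [Nonempty ι] {f : MvPolynomial (ι × ι) k} {N : ℕ}
    (h : ∀ p ≥ N, detPowCoeff ι k p f = 0) :
    reynolds f = ∑ p ∈ Finset.range N, detPowCoeff ι k p f :=
  finsum_eq_sum_of_support_subset _ fun p hp ↦ by
    simpa using not_le.1 fun h' ↦ hp (h p h')

theorem reynolds_one [Nonempty ι] : reynolds (1 : MvPolynomial (ι × ι) k) = 1 := by
  rw [reynolds_eq_sum (N := 1)]
  · simp [detPowCoeff_zero]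
  · exact fun p hp ↦ detPowCoeff_eq_zero (by simpa using Nat.lt_of_succ_le hp)

/-- Multiplication by `det` shifts the index by one, and the new term at `p = 0` is the constant
coefficient of `det * f`, which is zero. -/
theorem reynolds_genericDet_mul [Nonempty ι] [CharZero k] (f : MvPolynomial (ι × ι) k) :
    reynolds (genericDet ι k * f) = reynolds f := by
  obtain ⟨N, hN⟩ := exists_detPowCoeff_eq_zero f
  rw [reynolds_eq_sum hN, reynolds_eq_sum (N := N + 1), Finset.sum_range_succ', detPowCoeff_zero]
  · have : constantCoeff (genericDet ι k) = 0 := by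
      rw [constantCoeff_eq]
      exact (isHomogeneous_genericDet ι k).coeff_eq_zero
        (by simpa using Fintype.card_ne_zero.symm)
    simp [detPowCoeff_succ, this]
  · intro p hp
    obtain ⟨p, rfl⟩ := Nat.exists_eq_add_of_le' (Nat.one_le_of_lt hp)
    rw [detPowCoeff_succ, hN p (by omega)]

theorem lid_reynolds_rTensor [Nonempty ι] (a : Matrix ι ι R) (ha : a.det = 1)
    (f : MvPolynomial (ι × ι) k) :
    TensorProduct.lid k R (reynolds.rTensor R (linCoaction k (1 ⊗ₖ a.transpose) f)) =
      algebraMap k R (reynolds f) := by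
  -- A tensor involves finitely many polynomials, so one bound on `p` serves them all and a finite
  -- sum can replace the infinite one.
  have key (x : MvPolynomial (ι × ι) k ⊗[k] R) : ∃ N, ∀ M ≥ N,
      TensorProduct.lid k R (reynolds.rTensor R x) = ∑ p ∈ Finset.range M,
        TensorProduct.lid k R ((detPowCoeff ι k p).rTensor R x) := by
    induction x with
    | zero => exact ⟨0, by simp⟩
    | add x y hx hy =>
      obtain ⟨N, hN⟩ := hx
      obtain ⟨N', hN'⟩ := hy
      refine ⟨max N N', fun M hM ↦ ?_⟩
      rw [map_add, map_add, hN M (le_of_max_le_left hM), hN' M (le_of_max_le_right hM),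
        ← Finset.sum_add_distrib]
      simp only [map_add]
    | tmul g r =>
      obtain ⟨N, hN⟩ := exists_detPowCoeff_eq_zero g
      refine ⟨N, fun M hM ↦ ?_⟩
      simp [reynolds_eq_sum fun p hp ↦ hN p (hM.trans hp), Finset.sum_smul]
  obtain ⟨N, hN⟩ := exists_detPowCoeff_eq_zero f
  obtain ⟨N', hN'⟩ := key (linCoaction k (1 ⊗ₖ a.transpose) f)
  rw [hN' (max N N') (le_max_right _ _),
    reynolds_eq_sum fun p hp ↦ hN p ((le_max_left N N').trans hp), map_sum]
  refine Finset.sum_congr rfl fun p _ ↦ ?_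
  rw [lid_detPowCoeff_rTensor_right, ha, one_pow, Algebra.algebraMap_eq_smul_one]

end Det

end MvPolynomial

/-! ### The coordinate ring of the special linear group -/

namespace AlgGroup

open scoped Kronecker
open MvPolynomial

variable {k : Type u} [Field k] {A : Type u} [CommRing A] [HopfAlgebra k A]
  {S : ObjectProperty (Comod k A)}

/-- For an algebra homomorphism, the axioms of a coaction can be checked on generators. -/
theorem isCoaction_of_adjoin_eq_top {B : Type u} [CommRing B] [Algebra k B]
    (β : B →ₐ[k] B ⊗[k] A) {s : Set B} (hs : Algebra.adjoin k s = ⊤)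
    (h1 : ∀ b ∈ s, counitMap k A B (β b) = b)
    (h2 : ∀ b ∈ s, comulMap k A B (β b) = β.toLinearMap.rTensor A (β b)) :
    IsCoaction β.toLinearMap where
  counit := by
    have h : ((Algebra.TensorProduct.rid k k B).toAlgHom.comp
        (Algebra.TensorProduct.map (AlgHom.id k B) (Bialgebra.counitAlgHom k A))).comp β =
        AlgHom.id k B :=
      AlgHom.ext_of_adjoin_eq_top hs fun b hb ↦ h1 b hb
    exact congrArg AlgHom.toLinearMap h
  coassoc := by
    have h : ((Algebra.TensorProduct.assoc k k k B A A).symm.toAlgHom.comp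
        (Algebra.TensorProduct.map (AlgHom.id k B) (Bialgebra.comulAlgHom k A))).comp β =
        (Algebra.TensorProduct.map β (AlgHom.id k A)).comp β :=
      AlgHom.ext_of_adjoin_eq_top hs fun b hb ↦ h2 b hb
    exact congrArg AlgHom.toLinearMap h

/-- The span is the range of an algebra homomorphism `B ⊗ B → B ⊗ A`. It contains `B ⊗ 1`, so
generators of `A` suffice. -/
theorem span_mul_eq_top {B : Type u} [CommRing B] [Algebra k B] (β : B →ₐ[k] B ⊗[k] A)
    {s : Set A} (hs : Algebra.adjoin k s = ⊤)
    (h : ∀ a ∈ s, (1 : B) ⊗ₜ[k] a ∈ (Algebra.TensorProduct.productMap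
      (Algebra.TensorProduct.includeLeft : B →ₐ[k] B ⊗[k] A) β).range) :
    Submodule.span k (Set.range fun x : B × B ↦ (x.1 ⊗ₜ[k] (1 : A)) * β x.2) = ⊤ := by
  set φ := Algebra.TensorProduct.productMap
    (Algebra.TensorProduct.includeLeft : B →ₐ[k] B ⊗[k] A) β with hφ
  have h1 (a : A) : (1 : B) ⊗ₜ[k] a ∈ φ.range := by
    have : Algebra.adjoin k s ≤
        φ.range.comap (Algebra.TensorProduct.includeRight : A →ₐ[k] B ⊗[k] A) :=
      Algebra.adjoin_le h
    rw [hs] at this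
    exact this (Algebra.mem_top (x := a))
  have h2 (z : B ⊗[k] A) : z ∈ φ.range := by
    induction z with
    | zero => exact zero_mem _
    | add x y hx hy => exact add_mem hx hy
    | tmul b a =>
      have : b ⊗ₜ[k] a = φ (b ⊗ₜ 1) * 1 ⊗ₜ a := by simp [hφ]
      rw [this]
      exact mul_mem ⟨_, rfl⟩ (h1 a)
  rw [eq_top_iff]
  rintro z -
  obtain ⟨y, rfl⟩ := h2 z
  change φ y ∈ _
  induction y with
  | zero => rw [map_zero]; exact zero_mem _
  | add x y hx hy => rw [map_add]; exact add_mem hx hy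
  | tmul b b' => exact Submodule.subset_span ⟨(b, b'), by simp [hφ]⟩

section SpecialLinear

variable {ι : Type} [Fintype ι] [DecidableEq ι]

variable (k ι) in
/-- The coordinate ring of the special linear group. -/
def SLCoord : Type u := MvPolynomial (ι × ι) k ⧸ Ideal.span {genericDet ι k - 1}

instance : CommRing (SLCoord k ι) :=
  inferInstanceAs (CommRing (MvPolynomial (ι × ι) k ⧸ Ideal.span {genericDet ι k - 1}))

instance : Algebra k (SLCoord k ι) :=
  inferInstanceAs (Algebra k (MvPolynomial (ι × ι) k ⧸ Ideal.span {genericDet ι k - 1}))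

instance : IsNoetherianRing (SLCoord k ι) :=
  inferInstanceAs (IsNoetherianRing (MvPolynomial (ι × ι) k ⧸ Ideal.span {genericDet ι k - 1}))

variable (k ι) in
/-- The restriction of polynomial functions on matrices to the special linear group. -/
def slMk : MvPolynomial (ι × ι) k →ₐ[k] SLCoord k ι :=
  Ideal.Quotient.mkₐ k (Ideal.span {genericDet ι k - 1})

theorem slMk_surjective : Function.Surjective (slMk k ι) :=
  Ideal.Quotient.mkₐ_surjective k _

theorem slMk_genericDet : slMk k ι (genericDet ι k) = 1 := by
  rw [← sub_eq_zero, ← map_one (slMk k ι), ← map_sub]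
  exact Ideal.Quotient.eq_zero_iff_mem.2 (Ideal.mem_span_singleton_self _)

/-- The universal property of the coordinate ring of the special linear group. -/
def slLift {R : Type u} [CommRing R] [Algebra k R] (φ : MvPolynomial (ι × ι) k →ₐ[k] R)
    (hφ : φ (genericDet ι k) = 1) : SLCoord k ι →ₐ[k] R :=
  Ideal.Quotient.liftₐ (Ideal.span {genericDet ι k - 1}) φ fun f hf ↦ by
    obtain ⟨g, rfl⟩ := Ideal.mem_span_singleton.1 hf
    rw [map_mul, map_sub, hφ, map_one, sub_self, zero_mul]

theorem slLift_slMk {R : Type u} [CommRing R] [Algebra k R] (φ : MvPolynomial (ι × ι) k →ₐ[k] R)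
    (hφ : φ (genericDet ι k) = 1) (f : MvPolynomial (ι × ι) k) : slLift φ hφ (slMk k ι f) = φ f :=
  rfl

variable (k ι) in
/-- The generic matrix of determinant one. -/
def slMatrix : Matrix ι ι (SLCoord k ι) :=
  (slMk k ι).mapMatrix (Matrix.mvPolynomialX ι ι k)

theorem slMatrix_apply (i j : ι) : slMatrix k ι i j = slMk k ι (X (i, j)) :=
  rfl

theorem det_slMatrix : (slMatrix k ι).det = 1 := by
  rw [slMatrix, ← AlgHom.map_det]
  exact slMk_genericDet

theorem adjoin_slMatrix :
    Algebra.adjoin k (Set.range fun p : ι × ι ↦ slMatrix k ι p.1 p.2) = ⊤ := by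
  have h := congrArg (Subalgebra.map (slMk k ι))
    (MvPolynomial.adjoin_range_X (R := k) (σ := ι × ι))
  rw [AlgHom.map_adjoin, ← Set.range_comp, Algebra.map_top,
    (AlgHom.range_eq_top _).2 slMk_surjective] at h
  exact h

variable {a : Matrix ι ι A}

variable (k) in
/-- Right multiplication by a matrix of determinant one, on the coordinate ring of the special
linear group. -/
def slCoaction (a : Matrix ι ι A) (ha : a.det = 1) : SLCoord k ι →ₐ[k] SLCoord k ι ⊗[k] A :=
  slLift ((Algebra.TensorProduct.map (slMk k ι) (AlgHom.id k A)).comp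
    (linCoaction k (1 ⊗ₖ a.transpose))) (by
      rw [AlgHom.comp_apply, linCoaction_genericDet, ha, Algebra.TensorProduct.map_tmul,
        slMk_genericDet, map_one, ← Algebra.TensorProduct.one_def])

theorem slCoaction_slMk (ha : a.det = 1) (f : MvPolynomial (ι × ι) k) :
    slCoaction k a ha (slMk k ι f) =
      (slMk k ι).toLinearMap.rTensor A (linCoaction k (1 ⊗ₖ a.transpose) f) :=
  slLift_slMk _ _ _

theorem slCoaction_slMatrix (ha : a.det = 1) (i j : ι) :
    slCoaction k a ha (slMatrix k ι i j) = ∑ l, slMatrix k ι i l ⊗ₜ a l j := by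
  rw [slMatrix_apply, slCoaction_slMk, linCoaction_X]
  simp [Fintype.sum_prod_type_right, Matrix.one_apply, TensorProduct.tmul_ite, slMatrix_apply]

theorem isCoaction_slCoaction (ha : a.det = 1)
    (hΔ : ∀ i j, Coalgebra.comul (R := k) (a i j) = ∑ l, a i l ⊗ₜ[k] a l j)
    (hε : ∀ i j, Coalgebra.counit (R := k) (a i j) = (1 : Matrix ι ι k) i j) :
    IsCoaction (slCoaction k a ha).toLinearMap := by
  refine isCoaction_of_adjoin_eq_top _ adjoin_slMatrix ?_ ?_
  · rintro _ ⟨⟨i, j⟩, rfl⟩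
    simp [slCoaction_slMatrix, counitMap, hε, Matrix.one_apply]
  · rintro _ ⟨⟨i, j⟩, rfl⟩
    simp only [slCoaction_slMatrix, map_sum, comulMap, LinearMap.comp_apply, LinearMap.lTensor_tmul,
      hΔ, tmul_sum, LinearMap.rTensor_tmul, AlgHom.toLinearMap_apply, sum_tmul,
      LinearEquiv.coe_coe, TensorProduct.assoc_symm_tmul]
    exact Finset.sum_comm

/-- The coaction sends the generic matrix `X` to `X a`, and `a = adj(X) (X a)` because `det X = 1`.
On points this is `h = g⁻¹ (g h)`. -/
theorem span_slCoaction (ha : a.det = 1)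
    (hgen : Algebra.adjoin k (Set.range fun p : ι × ι ↦ a p.1 p.2) = ⊤) :
    Submodule.span k (Set.range fun x : SLCoord k ι × SLCoord k ι ↦
      (x.1 ⊗ₜ[k] (1 : A)) * slCoaction k a ha x.2) = ⊤ := by
  let incl : SLCoord k ι →ₐ[k] SLCoord k ι ⊗[k] A := Algebra.TensorProduct.includeLeft
  have h : (slCoaction k a ha).mapMatrix (slMatrix k ι) = incl.mapMatrix (slMatrix k ι) *
      (Algebra.TensorProduct.includeRight : A →ₐ[k] SLCoord k ι ⊗[k] A).mapMatrix a := by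
    ext i j
    simp [Matrix.mul_apply, slCoaction_slMatrix, incl]
  have h' : incl.mapMatrix (slMatrix k ι).adjugate *
      (slCoaction k a ha).mapMatrix (slMatrix k ι) =
      (Algebra.TensorProduct.includeRight : A →ₐ[k] SLCoord k ι ⊗[k] A).mapMatrix a := by
    rw [h, ← mul_assoc, ← map_mul, Matrix.adjugate_mul, det_slMatrix, one_smul, map_one, one_mul]
  have key (i j : ι) : Algebra.TensorProduct.productMap incl (slCoaction k a ha)
      (∑ l, (slMatrix k ι).adjugate i l ⊗ₜ slMatrix k ι l j) = (1 : SLCoord k ι) ⊗ₜ[k] a i j := by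
    have := Matrix.ext_iff.2 h' i j
    simpa [Matrix.mul_apply] using this
  refine span_mul_eq_top _ hgen ?_
  rintro _ ⟨p, rfl⟩
  exact ⟨_, key p.1 p.2⟩

variable [Nonempty ι] [CharZero k]

variable (k ι) in
/-- The Reynolds operator on the coordinate ring of the special linear group. -/
def slReynolds : SLCoord k ι →ₗ[k] k :=
  ((Ideal.span {genericDet ι k - 1}).restrictScalars k).liftQ reynolds (fun f hf ↦ by
    obtain ⟨g, rfl⟩ := Ideal.mem_span_singleton.1 hf
    rw [LinearMap.mem_ker, sub_mul, one_mul, map_sub, reynolds_genericDet_mul, sub_self]) ∘ₗ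
  (Submodule.Quotient.restrictScalarsEquiv k (Ideal.span {genericDet ι k - 1})).symm.toLinearMap

theorem slReynolds_comp_slMk : slReynolds k ι ∘ₗ (slMk k ι).toLinearMap = reynolds :=
  rfl

theorem lid_slReynolds_rTensor (ha : a.det = 1) (b : SLCoord k ι) :
    TensorProduct.lid k A ((slReynolds k ι).rTensor A (slCoaction k a ha b)) =
      algebraMap k A (slReynolds k ι b) := by
  obtain ⟨f, rfl⟩ := slMk_surjective b
  rw [slCoaction_slMk, ← LinearMap.rTensor_comp_apply, slReynolds_comp_slMk,
    lid_reynolds_rTensor a ha]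
  rfl

/-- If `A` is generated by the entries of a multiplicative matrix of determinant one, then every
filtered thick class of comodules that contains `A` contains everything. -/
theorem IsFilteredThick.eq_top_of_matrix (hS : IsFilteredThick S) (hA : S (regular k A))
    (a : Matrix ι ι A) (ha : a.det = 1)
    (hΔ : ∀ i j, Coalgebra.comul (R := k) (a i j) = ∑ l, a i l ⊗ₜ[k] a l j)
    (hε : ∀ i j, Coalgebra.counit (R := k) (a i j) = (1 : Matrix ι ι k) i j)
    (hgen : Algebra.adjoin k (Set.range fun p : ι × ι ↦ a p.1 p.2) = ⊤) (X : Comod k A) : S X :=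
  hS.eq_top (slCoaction k a ha) hA (isCoaction_slCoaction ha hΔ hε) (span_slCoaction ha hgen)
    (slReynolds k ι) (reynolds_one (k := k) (ι := ι)) (lid_slReynolds_rTensor ha) X

end SpecialLinear

end AlgGroup

/-! ### Embedding into a special linear group -/

namespace AlgGroup

variable {k : Type u} [Field k] {A : Type u} [CommRing A] [HopfAlgebra k A]
  {V W : Type u} [AddCommGroup V] [Module k V] [AddCommGroup W] [Module k W]
  {ρ : V →ₗ[k] V ⊗[k] A}

variable (V) in
/-- The contraction `V ⊗ A → V` with a linear form on `A`. -/
def slice (l : A →ₗ[k] k) : V ⊗[k] A →ₗ[k] V :=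
  (TensorProduct.rid k V).toLinearMap ∘ₗ l.lTensor V

@[simp]
theorem slice_tmul (l : A →ₗ[k] k) (v : V) (a : A) : slice V l (v ⊗ₜ a) = l a • v := by
  simp [slice]

theorem slice_rTensor (l : A →ₗ[k] k) (f : V →ₗ[k] W) (x : V ⊗[k] A) :
    slice W l (f.rTensor A x) = f (slice V l x) := by
  induction x with
  | zero => simp
  | add x y hx hy => simp only [map_add, hx, hy]
  | tmul v a => simp

theorem eq_zero_of_slice_eq_zero {x : V ⊗[k] A} (h : ∀ l, slice V l x = 0) : x = 0 := by
  classical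
  let b := Module.Free.chooseBasis k A
  apply (TensorProduct.equivFinsuppOfBasisRight (M := V) b).injective
  ext i
  rw [TensorProduct.equivFinsuppOfBasisRight_apply, map_zero]
  exact h _

theorem exists_finite_forall_slice_mem (x : V ⊗[k] A) :
    ∃ M : Submodule k V, M.FG ∧ ∀ l, slice V l x ∈ M := by
  induction x with
  | zero => exact ⟨⊥, Submodule.fg_bot, by simp⟩
  | add x y hx hy =>
    obtain ⟨M, hM, h⟩ := hx
    obtain ⟨N, hN, h'⟩ := hy
    exact ⟨M ⊔ N, hM.sup hN, fun l ↦ by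
      rw [map_add]
      exact Submodule.add_mem_sup (h l) (h' l)⟩
  | tmul v a =>
    exact ⟨Submodule.span k {v}, Submodule.fg_span_singleton v, fun l ↦ by
      rw [slice_tmul]
      exact Submodule.smul_mem _ _ (Submodule.mem_span_singleton_self v)⟩

/-- Every element of a comodule lies in a finite-dimensional stable subspace. -/
theorem IsCoaction.exists_finite_isStable (hρ : IsCoaction ρ) (v : V) :
    ∃ M : Submodule k V, M.FG ∧ IsStable ρ M ∧ v ∈ M := by
  -- The subspace consists of all slices of `ρ v`; `v` itself is the slice by the counit.
  let F : (A →ₗ[k] k) →ₗ[k] V :=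
    { toFun l := slice V l (ρ v)
      map_add' l l' := by simp [slice, LinearMap.lTensor_add]
      map_smul' c l := by simp [slice, LinearMap.lTensor_smul] }
  obtain ⟨N, hN, h⟩ := exists_finite_forall_slice_mem (ρ v)
  have hF : LinearMap.range F ≤ N := by
    rintro _ ⟨l, rfl⟩
    exact h l
  have : Module.Finite k N := Module.Finite.iff_fg.2 hN
  refine ⟨LinearMap.range F, ?_, ?_, ⟨Coalgebra.counit, LinearMap.congr_fun hρ.counit v⟩⟩
  · exact Module.Finite.iff_fg.1 (Submodule.finiteDimensional_of_le hF)
  · rintro _ ⟨l, rfl⟩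
    have h1 (x : V ⊗[k] A) : slice (V ⊗[k] A) l (comulMap k A V x) =
        (slice A l ∘ₗ Coalgebra.comul).lTensor V x := by
      induction x with
      | zero => simp
      | add x y hx hy => simp only [map_add, hx, hy]
      | tmul v a =>
        simp only [comulMap, LinearMap.comp_apply, LinearMap.lTensor_tmul, LinearEquiv.coe_coe]
        induction Coalgebra.comul (R := k) a with
        | zero => simp
        | add x y hx hy => simp only [tmul_add, map_add, hx, hy]
        | tmul a b => simp
    -- By coassociativity, `ρ` of a slice of `ρ v` arises from `ρ v` by a map on the factor `A`
    -- alone, so its components in `V` are again slices of `ρ v`.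
    have h2 : ρ (F l) = (slice A l ∘ₗ Coalgebra.comul).lTensor V (ρ v) := by
      rw [← h1, show comulMap k A V (ρ v) = ρ.rTensor A (ρ v) from
        LinearMap.congr_fun hρ.coassoc v, slice_rTensor]
      rfl
    have h3 : (LinearMap.range F).mkQ.rTensor A (ρ v) = 0 := by
      refine eq_zero_of_slice_eq_zero fun l ↦ ?_
      rw [slice_rTensor]
      exact (Submodule.Quotient.mk_eq_zero _).2 ⟨l, rfl⟩
    rw [h2, ← LinearMap.comp_apply, LinearMap.rTensor_comp_lTensor, ← LinearMap.lTensor_comp_rTensor,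
      LinearMap.comp_apply, h3, map_zero]

theorem IsCoaction.exists_finite_isStable_finset (hρ : IsCoaction ρ) (s : Finset V) :
    ∃ M : Submodule k V, M.FG ∧ IsStable ρ M ∧ ∀ v ∈ s, v ∈ M := by
  choose M hM hM' h using hρ.exists_finite_isStable
  refine ⟨⨆ v : s, M v, Submodule.fg_iSup _ fun v ↦ hM v, isStable_iSup fun v ↦ hM' v,
    fun v hv ↦ ?_⟩
  exact le_iSup (fun v : s ↦ M v) ⟨v, hv⟩ (h v)

section Matrix

variable {ι : Type} [Fintype ι]

/-- The matrix of a coaction with respect to a basis. -/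
def coactionMatrix (ρ : V →ₗ[k] V ⊗[k] A) (e : Module.Basis ι k V) : Matrix ι ι A :=
  fun i j ↦ TensorProduct.lid k A ((e.coord i).rTensor A (ρ (e j)))

theorem apply_basis_eq_sum (e : Module.Basis ι k V) (j : ι) :
    ρ (e j) = ∑ i, e i ⊗ₜ coactionMatrix ρ e i j := by
  have h (x : V ⊗[k] A) : x = ∑ i, e i ⊗ₜ TensorProduct.lid k A ((e.coord i).rTensor A x) := by
    induction x with
    | zero => simp
    | add x y hx hy =>
      conv_lhs => rw [hx, hy]
      simp only [map_add, tmul_add, Finset.sum_add_distrib]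
    | tmul v a => simp [TensorProduct.smul_tmul', ← sum_tmul]
  exact h _

variable [DecidableEq ι]

theorem IsCoaction.counit_coactionMatrix (hρ : IsCoaction ρ) (e : Module.Basis ι k V) (i j : ι) :
    Coalgebra.counit (R := k) (coactionMatrix ρ e i j) = (1 : Matrix ι ι k) i j := by
  have h := LinearMap.congr_fun hρ.counit (e j)
  rw [LinearMap.comp_apply, apply_basis_eq_sum e j] at h
  have h' := congrArg (e.coord i) h
  simpa [counitMap, Finsupp.single_apply, Matrix.one_apply, eq_comm] using h'

theorem IsCoaction.comul_coactionMatrix (hρ : IsCoaction ρ) (e : Module.Basis ι k V) (i j : ι) :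
    Coalgebra.comul (R := k) (coactionMatrix ρ e i j) =
      ∑ l, coactionMatrix ρ e i l ⊗ₜ[k] coactionMatrix ρ e l j := by
  have h := LinearMap.congr_fun hρ.coassoc (e j)
  rw [LinearMap.comp_apply, LinearMap.comp_apply, apply_basis_eq_sum e j] at h
  have h' := congrArg (fun x ↦ TensorProduct.lid k (A ⊗[k] A) ((e.coord i).rTensor (A ⊗[k] A)
    (TensorProduct.assoc k V A A x))) h
  simpa [comulMap, apply_basis_eq_sum, sum_tmul, Finsupp.single_apply, TensorProduct.ite_tmul]
    using h'

end Matrix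

section Unimodular

variable {ι : Type} [Fintype ι] [DecidableEq ι] {a : Matrix ι ι A}

/-- The antipode axiom says that the matrix `S(a)` is inverse to `a`. -/
theorem det_mul_det_antipode
    (hΔ : ∀ i j, Coalgebra.comul (R := k) (a i j) = ∑ l, a i l ⊗ₜ[k] a l j)
    (hε : ∀ i j, Coalgebra.counit (R := k) (a i j) = (1 : Matrix ι ι k) i j) :
    a.det * (a.map (HopfAlgebra.antipode k)).det = 1 := by
  rw [← Matrix.det_mul]
  convert Matrix.det_one (n := ι) (R := A)
  ext i j
  have h := HopfAlgebra.mul_antipode_lTensor_comul_apply (R := k) (a i j)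
  rw [hΔ, hε] at h
  simpa [Matrix.mul_apply, Matrix.one_apply, apply_ite] using h

theorem comul_det (hΔ : ∀ i j, Coalgebra.comul (R := k) (a i j) = ∑ l, a i l ⊗ₜ[k] a l j) :
    Coalgebra.comul (R := k) a.det = a.det ⊗ₜ[k] a.det := by
  have h : (Bialgebra.comulAlgHom k A).mapMatrix a =
      (Algebra.TensorProduct.includeLeft : A →ₐ[k] A ⊗[k] A).mapMatrix a *
        (Algebra.TensorProduct.includeRight : A →ₐ[k] A ⊗[k] A).mapMatrix a := by
    ext i j
    simp [Matrix.mul_apply, hΔ]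
  have h' := congrArg Matrix.det h
  rw [Matrix.det_mul, ← AlgHom.map_det, ← AlgHom.map_det, ← AlgHom.map_det] at h'
  simpa using h'

theorem counit_det (hε : ∀ i j, Coalgebra.counit (R := k) (a i j) = (1 : Matrix ι ι k) i j) :
    Coalgebra.counit (R := k) a.det = 1 := by
  have h : (Bialgebra.counitAlgHom k A).mapMatrix a = 1 := by
    ext i j
    exact hε i j
  have h' := congrArg Matrix.det h
  rwa [← AlgHom.map_det, Matrix.det_one] at h'

theorem comul_eq_of_mul_eq_one {d c : A} (h : d * c = 1)
    (hd : Coalgebra.comul (R := k) d = d ⊗ₜ[k] d) : Coalgebra.comul (R := k) c = c ⊗ₜ[k] c := by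
  have h1 : (c ⊗ₜ[k] c) * (d ⊗ₜ[k] d) = 1 := by
    rw [Algebra.TensorProduct.tmul_mul_tmul, mul_comm, h, Algebra.TensorProduct.one_def]
  have h2 : (d ⊗ₜ[k] d) * Coalgebra.comul (R := k) c = 1 := by
    rw [← hd, ← Bialgebra.comul_mul, h, Bialgebra.comul_one]
  exact (left_inv_eq_right_inv h1 h2).symm

theorem counit_eq_of_mul_eq_one {d c : A} (h : d * c = 1)
    (hd : Coalgebra.counit (R := k) d = 1) : Coalgebra.counit (R := k) c = 1 := by
  have := congrArg (Coalgebra.counit (R := k)) h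
  rwa [Bialgebra.counit_mul, hd, one_mul, Bialgebra.counit_one] at this

end Unimodular

variable (k A) in
/-- An affine algebraic group is a closed subgroup of a special linear group. -/
theorem exists_matrix [Algebra.FiniteType k A] :
    ∃ (n : ℕ) (a : Matrix (Fin n ⊕ Unit) (Fin n ⊕ Unit) A), a.det = 1 ∧
      (∀ i j, Coalgebra.comul (R := k) (a i j) = ∑ l, a i l ⊗ₜ[k] a l j) ∧
      (∀ i j, Coalgebra.counit (R := k) (a i j) =
        (1 : Matrix (Fin n ⊕ Unit) (Fin n ⊕ Unit) k) i j) ∧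
      Algebra.adjoin k
        (Set.range fun p : (Fin n ⊕ Unit) × (Fin n ⊕ Unit) ↦ a p.1 p.2) = ⊤ := by
  obtain ⟨s, hs⟩ := Algebra.FiniteType.out (R := k) (A := A)
  have hρ : IsCoaction (Coalgebra.comul (R := k) (A := A)) := isCoaction_comul
  obtain ⟨M, hM, hst, hsM⟩ := hρ.exists_finite_isStable_finset s
  have : Module.Finite k M := Module.Finite.iff_fg.2 hM
  let e := Module.finBasis k M
  have hr := hρ.restrict M hst
  let a := coactionMatrix (restrict _ M hst) e
  have hΔ := hr.comul_coactionMatrix e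
  have hε := hr.counit_coactionMatrix e
  let c := (a.map (HopfAlgebra.antipode k)).det
  have hc : a.det * c = 1 := det_mul_det_antipode hΔ hε
  have hcΔ := comul_eq_of_mul_eq_one hc (comul_det hΔ)
  have hcε := counit_eq_of_mul_eq_one hc (counit_det hε)
  -- The grouplike element `c = (det a)⁻¹` is added as a block of size one to make the determinant
  -- `1`. It also keeps the index type nonempty when `M = 0`, as the Reynolds operator requires.
  refine ⟨_, Matrix.fromBlocks a 0 0 (Matrix.of fun _ _ ↦ c), ?_, ?_, ?_, ?_⟩
  · rw [Matrix.det_fromBlocks_zero₂₁, Matrix.det_unique (n := Unit)]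
    exact hc
  · rintro (i | i) (j | j)
    · simp [a, hΔ]
    · simp
    · simp
    · simp [hcΔ]
  · rintro (i | i) (j | j)
    · simp [a, hε, Matrix.one_apply]
    · simp
    · simp
    · simp [hcε]
  · set T := Algebra.adjoin k (Set.range fun p : (Fin _ ⊕ Unit) × (Fin _ ⊕ Unit) ↦
      Matrix.fromBlocks a 0 0 (Matrix.of fun _ _ ↦ c) p.1 p.2)
    have ha (i j) : a i j ∈ T := Algebra.subset_adjoin ⟨(Sum.inl i, Sum.inl j), rfl⟩
    -- Applying the counit to the left factor of `Δ (e j)` writes `e j` as a linear combination of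
    -- the entries of column `j`.
    have he (j) : (e j : A) ∈ T := by
      have h1 := LinearMap.congr_fun (isColinear_subtype M hst) (e j)
      rw [LinearMap.comp_apply, LinearMap.comp_apply, apply_basis_eq_sum e j] at h1
      have h2 := congrArg
        (fun x ↦ TensorProduct.lid k A ((Coalgebra.counit (R := k)).rTensor A x)) h1
      simp at h2
      rw [h2]
      exact sum_mem fun i _ ↦ T.smul_mem (ha i j) _
    have hMT : ∀ m : M, (m : A) ∈ T := fun m ↦ by
      rw [← e.sum_repr m]
      push_cast
      exact sum_mem fun i _ ↦ T.smul_mem (he i) _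
    rw [eq_top_iff, ← hs]
    exact Algebra.adjoin_le fun x hx ↦ hMT ⟨x, hsM x hx⟩

end AlgGroup

end

theorem lemmal (k : Type u) [Field k] [IsAlgClosed k] [CharZero k]
    (A : Type u) [CommRing A] [HopfAlgebra k A] [Algebra.FiniteType k A] :
    AlgGroup.GeneratesUnderFilteredColimits (AlgGroup.dgRegular k A) := by
  obtain ⟨n, a, ha, hΔ, hε, hgen⟩ := AlgGroup.exists_matrix k A
  exact AlgGroup.generatesUnderFilteredColimits_of_forall
    fun S hS hA X ↦ hS.eq_top_of_matrix hA a ha hΔ hε hgen X
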